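/- Let $\mathbb{H}$ be the Poincaré disc, i.e. the open unit disc of $\mathbb{C}$ with the hyperbolic distance $d_{\mathbb{H}}$ induced by the Riemannian metric $4|dw|^2/(1-|w|^2)^2$. The polar coordinates $(r(w),\theta(w))$ of $w\in\mathbb{H}$ are its hyperbolic distance $r(w)$ to the centre $0$ (its radius) and its angle $\theta(w)$ in the complex plane. Fix $\alpha>0$ and $\nu>0$, and for an integer $n>\nu$ set $R_n=2\log(n/\nu)$. Let $\mu_n$ be the law of the random point of $\mathbb{H}$ whose polar coordinates $(r,\theta)$ are independent, with $\theta$ uniform on $(-\pi,\pi]$ and $r$ having density $$\rho_n(r)=\frac{\alpha\sinh(\alpha r)}{\cosh(\alpha R_n)-1}\,\mathbf{1}_{\{0\le r<R_n\}}.$$ The random hyperbolic graph $\mathcal{G}_{\alpha,\nu}(n)$ has as nodes $n$ independent points $X_1,\dots,X_n$ with law $\mu_n$, two distinct nodes being joined by an edge if and only if their hyperbolic distance is at most $R_n$. Write $\deg(X_i)$ for the number of neighbours of $X_i$, and let $X_{(1)},\dots,X_{(n)}$ be a reordering of the nodes by increasing radius, $r(X_{(1)})\le r(X_{(2)})\le\dots\le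 r(X_{(n)})$. **Theorem 3.1.** For all fixed $\alpha>0$, $\nu>0$ and every fixed integer $k\ge 1$, the probability of the event $$\deg(X_{(1)})>\deg(X_{(2)})>\dots>\deg(X_{(k)})>\deg(X_{(i)})\qquad\text{for all } k<i\le n$$ tends to $1$ as $n\to\infty$. -/

import Mathlib

open Filter Topology MeasureTheory ProbabilityTheory

noncomputable section

namespace RHG

open Complex.UnitDisc

/-- The Poincaré disc carries its Borel σ-algebra. -/
instance unitDiscMeasurableSpace : MeasurableSpace 𝔻 := borel 𝔻

instance unitDiscBorelSpace : BorelSpace 𝔻 := ⟨rfl⟩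

/-- The hyperbolic distance on the Poincaré disc, i.e. the distance induced by the Riemannian
metric `4 |dw|² / (1 - |w|²)²` (curvature `-1`), in the closed form
`d(z, w) = 2 arsinh (|z - w| / √((1 - |z|²) (1 - |w|²)))`. -/
def hypDist (z w : 𝔻) : ℝ :=
  2 * Real.arsinh (‖(z : ℂ) - (w : ℂ)‖ / √((1 - ‖(z : ℂ)‖ ^ 2) * (1 - ‖(w : ℂ)‖ ^ 2)))

theorem hypDist_comm (z w : 𝔻) : hypDist z w = hypDist w z := by
  rw [hypDist, hypDist, norm_sub_rev, mul_comm (1 - _)]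

/-- The radius of a point: its hyperbolic distance to the centre of the disc. -/
def radius (z : 𝔻) : ℝ := hypDist 0 z

theorem norm_polar_lt_one (r θ : ℝ) :
    ‖((Real.tanh (r / 2) : ℝ) : ℂ) * Complex.exp (θ * Complex.I)‖ < 1 := by
  rw [norm_mul, Complex.norm_exp_ofReal_mul_I, mul_one, Complex.norm_real, Real.norm_eq_abs]
  exact Real.abs_tanh_lt_one _

/-- The point of the Poincaré disc with polar coordinates `(r, θ)`: at hyperbolic distance `r`
from the centre (Euclidean modulus `tanh (r / 2)`), and with angle `θ` in the complex plane. -/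
def polar (p : ℝ × ℝ) : 𝔻 :=
  mk (((Real.tanh (p.1 / 2) : ℝ) : ℂ) * Complex.exp (p.2 * Complex.I))
    (norm_polar_lt_one p.1 p.2)

/-- `R_n = 2 log (n / ν)`. -/
def R (ν : ℝ) (n : ℕ) : ℝ := 2 * Real.log (n / ν)

/-- The density `ρ_n` of the radial coordinate; it vanishes outside `[0, R_n)`. -/
def radialDensity (α ν : ℝ) (n : ℕ) (r : ℝ) : ℝ :=
  Set.indicator (Set.Ico 0 (R ν n))
    (fun r => α * Real.sinh (α * r) / (Real.cosh (α * R ν n) - 1)) r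

/-- The law of the radial coordinate. -/
def radialLaw (α ν : ℝ) (n : ℕ) : Measure ℝ :=
  volume.withDensity (fun r => ENNReal.ofReal (radialDensity α ν n r))

/-- The law of the angular coordinate: uniform on `(-π, π]`. -/
def angularLaw : Measure ℝ := cond volume (Set.Ioc (-Real.pi) Real.pi)

/-- The measure `μ_n` on the Poincaré disc: the law of the point whose polar coordinates `(r, θ)`
are independent, `r` having density `ρ_n` and `θ` being uniform on `(-π, π]`. It is a probability
measure as soon as `n > ν`. -/
def nodeLaw (α ν : ℝ) (n : ℕ) : Measure 𝔻 :=
  ((radialLaw α ν n).prod angularLaw).map polar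

/-- The joint law of `n` independent points with law `μ_n`. -/
def nodesLaw (α ν : ℝ) (n : ℕ) : Measure (Fin n → 𝔻) :=
  Measure.pi (fun _ => nodeLaw α ν n)

/-- The graph whose nodes are the points `X i` (indexed by `i : Fin n`), two distinct nodes being
joined if and only if their hyperbolic distance is at most `R_n`. -/
def graph (ν : ℝ) {n : ℕ} (X : Fin n → 𝔻) : SimpleGraph (Fin n) where
  Adj i j := i ≠ j ∧ hypDist (X i) (X j) ≤ R ν n
  symm := ⟨fun i j h => ⟨h.1.symm, hypDist_comm (X i) (X j) ▸ h.2⟩⟩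
  loopless := ⟨fun _ h => h.1 rfl⟩

open scoped Classical in
/-- The degree of the `i`-th node. -/
def nodeDegree (ν : ℝ) {n : ℕ} (X : Fin n → 𝔻) (i : Fin n) : ℕ := (graph ν X).degree i

/-- `σ` is a reordering of the nodes by increasing radius: `X (σ 0), X (σ 1), …` have
non-decreasing radii. -/
def IsRadialOrdering {n : ℕ} (X : Fin n → 𝔻) (σ : Equiv.Perm (Fin n)) : Prop :=
  Monotone (fun i => radius (X (σ i)))

/-- The ordering event: for every reordering of the nodes by increasing radius, the degrees of
the first `k` nodes are strictly decreasing, and each of them exceeds the degree of every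
later node. Positions are counted from `0`, so the first `k` nodes are those at positions
`i < k`. -/
def orderingEvent (ν : ℝ) (k n : ℕ) : Set (Fin n → 𝔻) :=
  {X | ∀ σ : Equiv.Perm (Fin n), IsRadialOrdering X σ →
    (∀ i j : Fin n, i < j → (j : ℕ) < k →
      nodeDegree ν X (σ j) < nodeDegree ν X (σ i)) ∧
    (∀ i j : Fin n, (i : ℕ) < k → k ≤ (j : ℕ) →
      nodeDegree ν X (σ j) < nodeDegree ν X (σ i))}

end RHG

end

/-! ### Tail bounds for independent points. -/

section ProductMeasures

variable {E : Type*} [MeasurableSpace E] {ι : Type*} [Fintype ι]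

/-! Given its position, a node of radius r has a binomial degree with success probability p(r), the
mass `ballMass` of the ball of radius R_n around it. By convexity of hyperbolic balls p is
non-increasing, so degrees should follow radii as long as differences of p beat the binomial
fluctuations. Three scales, all powers of n, make this precise: a threshold radius M with P(radius ≤
M) = n^(g-1), a spacing η = n^(-b), and a resolution ε = n^(-1/2+g).

The ordering fails only if one of three things happens. Fewer than k nodes have radius at most M:
unlikely, since n^g are expected. Some node of radius at most M is followed by another within η:
bounded by a union over pairs. Or some pair with radii more than η apart, the inner one below M, has
its degrees in the wrong order. For such a pair, fix both positions; the other n - 2 nodes are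
independent, and a Chernoff bound controls the comparison by exp(-c n (√p - √p')²). The square roots
are the right scale because a binomial count of mean np fluctuates by √(np). A gap ε in √p therefore
costs exp(-c n^(2g)), which survives a union over n² pairs. This is `pi_real_not_ordered_le`.

The geometric input is `ballMass_gap`: moving a node outwards by η loses mass at least of order η
e^(-r/2), because a crescent of angular width of order e^(-r/2) and thickness of order η, close to
the rim where the radial density is bounded below, leaves the ball. To turn this into a gap for √p
one needs an upper bound for √p: for α > 1/2 it is of order e^(-r/4) (`ballMass_le`), and for α ≤
1/2 the bound 1 suffices, because the threshold then grows slowly enough. The spacing must be small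
enough to exclude close radii and large enough to keep the gap visible; `exists_exponents` shows
that both are possible for every α > 0. -/

/-- Exponential Markov inequality for independent coordinates. -/
theorem pi_real_mul_le_pow (μ : Measure E) [IsProbabilityMeasure μ] {g : E → ℝ}
    (hg : Measurable g) (h0 : ∀ x, 0 ≤ g x) {C : ℝ} (hC : ∀ x, g x ≤ C)
    (S : Set (ι → E)) {c : ℝ} (hc : 0 ≤ c) (hS : ∀ X ∈ S, c ≤ ∏ l, g (X l)) :
    c * (Measure.pi fun _ : ι => μ).real S ≤ (∫ x, g x ∂μ) ^ Fintype.card ι := by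
  have hint : Integrable (fun X : ι → E => ∏ l, g (X l)) (Measure.pi fun _ : ι => μ) := by
    refine Integrable.of_bound (C := ∏ _l : ι, C) ?_ (ae_of_all _ fun X => ?_)
    · exact (Finset.measurable_fun_prod _ fun l _ =>
        hg.comp (measurable_pi_apply l)).aestronglyMeasurable
    · rw [Real.norm_eq_abs, abs_of_nonneg (Finset.prod_nonneg fun l _ => h0 _)]
      exact Finset.prod_le_prod (fun l _ => h0 _) fun l _ => hC _
  have h1 := mul_meas_ge_le_integral_of_nonneg
    (ae_of_all _ fun X => Finset.prod_nonneg fun l _ => h0 _) hint c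
  rw [integral_fintype_prod_eq_prod (𝕜 := ℝ) (f := fun _ : ι => g), Finset.prod_const,
    Finset.card_univ] at h1
  refine le_trans ?_ h1
  gcongr
  · exact measure_ne_top _ _
  · exact fun X hX => hS X hX

open scoped Classical in
/-- Lower tail of the number of coordinates that lie in a set. -/
theorem pi_real_card_lt_le (μ : Measure E) [IsProbabilityMeasure μ] {A : Set E}
    (hA : MeasurableSet A) (k : ℕ) :
    (Measure.pi fun _ : ι => μ).real {X | (Finset.univ.filter fun l => X l ∈ A).card < k} ≤
      2 ^ k * Real.exp (-(Fintype.card ι * μ.real A / 2)) := by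
  -- Each point of A gets weight 1/2: fewer than k of them leave a product of at least 2^(-k), while
  -- the mean of one factor is 1 - μ(A)/2.
  have hg : Measurable (fun x => if x ∈ A then (2 : ℝ)⁻¹ else 1) :=
    Measurable.ite hA measurable_const measurable_const
  have h := pi_real_mul_le_pow μ hg (fun x => by split_ifs <;> norm_num) (C := 1)
    (fun x => by split_ifs <;> norm_num)
    {X : ι → E | (Finset.univ.filter fun l => X l ∈ A).card < k} (c := (2⁻¹) ^ k) (by positivity)
    (fun X hX => by
      rw [Finset.prod_ite, Finset.prod_const, Finset.prod_const_one, mul_one]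
      exact pow_le_pow_of_le_one (by norm_num) (by norm_num) (le_of_lt hX))
  have hint : ∫ x, (if x ∈ A then (2 : ℝ)⁻¹ else 1) ∂μ = 1 - μ.real A / 2 := by
    have : (fun x => if x ∈ A then (2 : ℝ)⁻¹ else 1) =
        fun x => 1 - A.indicator (fun _ => (2 : ℝ)⁻¹) x := by
      funext x
      by_cases hx : x ∈ A <;> simp [hx]; norm_num
    rw [this, integral_sub (integrable_const _) ((integrable_const _).indicator hA),
      integral_indicator hA]
    simp; ring
  rw [hint] at h
  have h2 : (1 - μ.real A / 2) ^ Fintype.card ι ≤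
      Real.exp (-(Fintype.card ι * μ.real A / 2)) := by
    calc _ ≤ (Real.exp (-(μ.real A / 2))) ^ Fintype.card ι := by
          refine pow_le_pow_left₀ ?_ (Real.one_sub_le_exp_neg _) _
          have : μ.real A ≤ 1 := measureReal_le_one
          linarith
      _ = _ := by rw [← Real.exp_nat_mul]; congr 1; ring
  have h3 := mul_le_mul_of_nonneg_left (h.trans h2) (show (0 : ℝ) ≤ 2 ^ k by positivity)
  rwa [← mul_assoc, ← mul_pow, show (2 : ℝ) * 2⁻¹ = 1 by norm_num, one_pow, one_mul] at h3

open scoped Classical in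
/-- Large deviation bound for the comparison of the numbers of coordinates in two sets. -/
theorem pi_real_card_le_card_le (μ : Measure E) [IsProbabilityMeasure μ] {A B : Set E}
    (hA : MeasurableSet A) (hB : MeasurableSet B) {w : ℝ} (hw : 0 < w)
    (hwB : √(μ.real B) ≤ w) (hwA : w ≤ √(μ.real A)) :
    (Measure.pi fun _ : ι => μ).real {X | (Finset.univ.filter fun l => X l ∈ A).card ≤
      (Finset.univ.filter fun l => X l ∈ B).card} ≤
      Real.exp (-(Fintype.card ι * (√(μ.real A) - w) ^ 2)) := by
  set q := √(μ.real A) with hq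
  -- The optimal tilt is √(μ(A)/μ(B)). Using a positive w ≥ √(μ(B)) in the denominator keeps it
  -- finite when μ(B) = 0.
  set u := q / w with hu
  have hu1 : 1 ≤ u := by rwa [hu, one_le_div hw]
  have hu0 : 0 < u := by linarith
  have hq0 : 0 < q := lt_of_lt_of_le hw hwA
  set g : E → ℝ := fun x => (if x ∈ A then u⁻¹ else 1) * (if x ∈ B then u else 1) with hg_def
  have hg : Measurable g := (Measurable.ite hA measurable_const measurable_const).mul
    (Measurable.ite hB measurable_const measurable_const)
  have hui : u⁻¹ ≤ 1 := inv_le_one_of_one_le₀ hu1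
  have hui0 : 0 < u⁻¹ := inv_pos.2 hu0
  have h0 : ∀ x, 0 ≤ g x := fun x => by
    simp only [hg_def]; split_ifs <;> positivity
  have hC : ∀ x, g x ≤ u := fun x => by
    simp only [hg_def]; split_ifs <;> nlinarith
  have h := pi_real_mul_le_pow μ hg h0 hC
    {X : ι → E | (Finset.univ.filter fun l => X l ∈ A).card ≤
      (Finset.univ.filter fun l => X l ∈ B).card} zero_le_one
    (fun X hX => by
      simp only [hg_def]
      rw [Finset.prod_mul_distrib, Finset.prod_ite, Finset.prod_ite]
      simp only [Finset.prod_const, one_pow, mul_one]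
      rw [inv_pow, inv_mul_eq_div, one_le_div (by positivity)]
      exact pow_le_pow_right₀ hu1 hX)
  rw [one_mul] at h
  refine h.trans ?_
  -- A and B may overlap. On the overlap the two weights cancel to 1, and 1 ≤ u + 1/u - 1.
  have hle : ∫ x, g x ∂μ ≤ ∫ x, (1 + A.indicator (fun _ => u⁻¹ - 1) x +
      B.indicator (fun _ => u - 1) x) ∂μ := by
    refine integral_mono (Integrable.of_bound hg.aestronglyMeasurable u
      (ae_of_all _ fun x => by rw [Real.norm_eq_abs, abs_of_nonneg (h0 x)]; exact hC x))
      (((integrable_const _).add ((integrable_const _).indicator hA)).add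
        ((integrable_const _).indicator hB)) fun x => ?_
    have : u⁻¹ * u = 1 := inv_mul_cancel₀ hu0.ne'
    by_cases h1 : x ∈ A <;> by_cases h2 : x ∈ B <;> simp [hg_def, h1, h2]
    nlinarith
  have heq : ∫ x, (1 + A.indicator (fun _ => u⁻¹ - 1) x + B.indicator (fun _ => u - 1) x) ∂μ
      = 1 + μ.real A * (u⁻¹ - 1) + μ.real B * (u - 1) := by
    rw [integral_add ((integrable_const _).add ((integrable_const _).indicator hA))
        ((integrable_const _).indicator hB),
      integral_add (integrable_const _) ((integrable_const _).indicator hA),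
      integral_indicator hA, integral_indicator hB]
    simp
  have hAq : μ.real A = q ^ 2 := (Real.sq_sqrt measureReal_nonneg).symm
  have hBw : μ.real B ≤ w ^ 2 := by
    rw [← Real.sqrt_le_left hw.le]; exact hwB
  have hval : ∫ x, g x ∂μ ≤ 1 - (q - w) ^ 2 := by
    rw [heq, hAq] at hle
    refine hle.trans ?_
    have e1 : q ^ 2 * (u⁻¹ - 1) = q * w - q ^ 2 := by
      rw [hu]; field_simp
    have e2 : w ^ 2 * (u - 1) = q * w - w ^ 2 := by
      rw [hu]; field_simp
    have e3 : μ.real B * (u - 1) ≤ w ^ 2 * (u - 1) :=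
      mul_le_mul_of_nonneg_right hBw (by linarith)
    nlinarith
  calc _ ≤ (Real.exp (-(q - w) ^ 2)) ^ Fintype.card ι := by
        refine pow_le_pow_left₀ (integral_nonneg h0) (hval.trans ?_) _
        exact Real.one_sub_le_exp_neg _
    _ = _ := by rw [← Real.exp_nat_mul]; congr 1; ring

/-- Two distinct coordinates of a product measure are independent with the given marginals. -/
theorem pi_real_pair (μ : Measure E) [IsProbabilityMeasure μ] {i j : ι} (hij : i ≠ j)
    {S : Set (E × E)} (hS : MeasurableSet S) :
    (Measure.pi fun _ : ι => μ).real {X | (X i, X j) ∈ S} = (μ.prod μ).real S := by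
  have hind : IndepFun (fun X : ι → E => X i) (fun X : ι → E => X j)
      (Measure.pi fun _ : ι => μ) :=
    (iIndepFun_pi (X := fun _ : ι => id) (μ := fun _ : ι => μ)
      (fun _ => aemeasurable_id)).indepFun hij
  have h := (indepFun_iff_map_prod_eq_prod_map_map (measurable_pi_apply i).aemeasurable
    (measurable_pi_apply j).aemeasurable).1 hind
  have hi : ∀ l : ι, (Measure.pi fun _ : ι => μ).map (fun X : ι → E => X l) = μ :=
    fun l => (measurePreserving_eval (fun _ : ι => μ) l).map_eq
  rw [hi, hi] at h
  rw [← h, map_measureReal_apply (by fun_prop) hS]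
  rfl

/-- A bound for a probability from a uniform bound for the conditional probabilities given the
coordinates that satisfy `p`. -/
theorem pi_real_le_of_forall_cond (μ : Measure E) [IsProbabilityMeasure μ] (p : ι → Prop)
    [DecidablePred p] {S : Set (ι → E)} (hS : MeasurableSet S) {c : ℝ} (hc : 0 ≤ c)
    (h : ∀ y : {l // p l} → E, (Measure.pi fun _ : {l // ¬ p l} => μ).real
      {z | (MeasurableEquiv.piEquivPiSubtypeProd (fun _ => E) p).symm (y, z) ∈ S} ≤ c) :
    (Measure.pi fun _ : ι => μ).real S ≤ c := by
  have hmp := (measurePreserving_piEquivPiSubtypeProd (fun _ : ι => μ) p).symm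
  have h1 := hmp.measure_preimage hS.nullMeasurableSet
  rw [measureReal_def, ← h1, Measure.prod_apply (hmp.measurable hS)]
  refine ENNReal.toReal_le_of_le_ofReal hc ?_
  calc _ ≤ ∫⁻ _y, ENNReal.ofReal c ∂(Measure.pi fun _ : {l // p l} => μ) := by
        refine lintegral_mono fun y => ?_
        rw [← ENNReal.ofReal_toReal (measure_ne_top _ _)]
        exact ENNReal.ofReal_le_ofReal (h y)
    _ = _ := by simp

end ProductMeasures

/-! ### Degrees of independent points in an abstract neighbourhood structure. -/

section Neighbourhoods

open scoped Classical in
/-- The number of other points that lie in the neighbourhood of the `i`-th point. -/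
noncomputable def neighborCount {E : Type*} (B : E → Set E) {n : ℕ} (X : Fin n → E) (i : Fin n) : ℕ :=
  (Finset.univ.filter fun l => l ≠ i ∧ X l ∈ B (X i)).card

-- Isolates the possible edge between i and j. Once X i and X j are fixed, the remaining count runs
-- over independent points.
open scoped Classical in
theorem neighborCount_eq_add {E : Type*} (B : E → Set E) {n : ℕ} (X : Fin n → E) {i j : Fin n}
    (hij : i ≠ j) :
    neighborCount B X i = (if X j ∈ B (X i) then 1 else 0) +
      (Finset.univ.filter fun l : {l // ¬ (l = i ∨ l = j)} => X l ∈ B (X i)).card := by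
  rw [neighborCount, Finset.card_filter, Finset.card_filter,
    ← Fintype.sum_subtype_add_sum_subtype (fun l => l = i ∨ l = j)]
  congr 1
  · rw [← Finset.sum_subtype (s := {i, j}) (by simp)
      (f := fun l => if l ≠ i ∧ X l ∈ B (X i) then 1 else 0), Finset.sum_pair hij]
    simp [hij.symm]
  · refine Finset.sum_congr rfl fun l _ => ?_
    have : l.1 ≠ i := fun h => l.2 (Or.inl h)
    simp [this]

theorem measurable_neighborCount {E : Type*} [MeasurableSpace E] {B : E → Set E}
    (hB : MeasurableSet {p : E × E | p.2 ∈ B p.1}) {n : ℕ} (i : Fin n) :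
    Measurable fun X : Fin n → E => neighborCount B X i := by
  classical
  simp only [neighborCount, Finset.card_filter]
  refine Finset.measurable_fun_sum _ fun l _ => ?_
  refine Measurable.ite ?_ measurable_const measurable_const
  have h : Measurable fun X : Fin n → E => (X i, X l) := by fun_prop
  exact (MeasurableSet.const _).inter (h hB)

/-- If the mass of the neighbourhood decreases by a definite amount from a point of radius at most
`M` to any point whose radius is larger by `η`, then it is unlikely that the second one of two
given points with this property has at least as many neighbours as the first one. -/
theorem pi_real_neighborCount_le {E : Type*} [MeasurableSpace E] (μ : Measure E)
    [IsProbabilityMeasure μ] {rad : E → ℝ} (hrad : Measurable rad) {B : E → Set E}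
    (hB : MeasurableSet {p : E × E | p.2 ∈ B p.1}) (hsymm : ∀ x y, y ∈ B x → x ∈ B y)
    {M η ε : ℝ} (hε : 0 < ε)
    (hgap : ∀ x y, rad x ≤ M → rad x + η < rad y → √(μ.real (B y)) + ε ≤ √(μ.real (B x)))
    {n : ℕ} {i j : Fin n} (hij : i ≠ j) :
    (Measure.pi fun _ : Fin n => μ).real {X | rad (X i) ≤ M ∧ rad (X i) + η < rad (X j) ∧
      neighborCount B X i ≤ neighborCount B X j} ≤
      Real.exp (-(((n : ℝ) - 2) * ε ^ 2 / 4)) := by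
  classical
  refine pi_real_le_of_forall_cond μ (fun l => l = i ∨ l = j) ?_ (Real.exp_pos _).le fun y => ?_
  · refine (measurableSet_le (hrad.comp (measurable_pi_apply i)) measurable_const).inter
      ((measurableSet_lt ((hrad.comp (measurable_pi_apply i)).add measurable_const)
        (hrad.comp (measurable_pi_apply j))).inter ?_)
    exact measurableSet_le (measurable_neighborCount hB i) (measurable_neighborCount hB j)
  set x1 := y ⟨i, Or.inl rfl⟩
  set x2 := y ⟨j, Or.inr rfl⟩
  by_cases hr : rad x1 ≤ M ∧ rad x1 + η < rad x2
  · have hg := hgap x1 x2 hr.1 hr.2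
    have hBm : ∀ x, MeasurableSet (B x) := fun x => measurable_prodMk_left hB
    have hq2 : 0 ≤ √(μ.real (B x2)) := Real.sqrt_nonneg _
    -- Giving up half of ε keeps w at least ε/2, hence positive, even if the outer ball has no mass;
    -- this is the source of ε²/4.
    have h := pi_real_card_le_card_le (ι := {l // ¬ (l = i ∨ l = j)}) μ (hBm x1) (hBm x2)
      (w := √(μ.real (B x1)) - ε / 2) (by linarith) (by linarith) (by linarith)
    have hcard : (Fintype.card {l // ¬ (l = i ∨ l = j)} : ℝ) = (n : ℝ) - 2 := by
      have h2 : Fintype.card {l // l = i ∨ l = j} = 2 := by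
        rw [Fintype.card_subtype, ← Finset.card_pair hij]
        congr 1
        ext l; simp
      have h3 := Fintype.card_subtype_compl (fun l => l = i ∨ l = j)
      have h4 : Fintype.card {l // l = i ∨ l = j} ≤ Fintype.card (Fin n) :=
        Fintype.card_subtype_le _
      rw [h3, Nat.cast_sub h4, h2, Fintype.card_fin]
      norm_num
    rw [hcard] at h
    refine (measureReal_mono ?_ (measure_ne_top _ _)).trans (h.trans (le_of_eq ?_))
    · intro z hz
      obtain ⟨-, -, hz⟩ := hz
      rw [neighborCount_eq_add B _ hij, neighborCount_eq_add B _ hij.symm] at hz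
      set X := (MeasurableEquiv.piEquivPiSubtypeProd (fun _ => E)
        fun l => l = i ∨ l = j).symm (y, z) with hX
      have hXi : X i = x1 := by
        simp [hX, MeasurableEquiv.piEquivPiSubtypeProd, Equiv.piEquivPiSubtypeProd, x1]
      have hXj : X j = x2 := by
        simp [hX, MeasurableEquiv.piEquivPiSubtypeProd, Equiv.piEquivPiSubtypeProd, x2]
      have hXl : ∀ l : {l // ¬ (l = i ∨ l = j)}, X l = z l := fun l => by
        have := l.2
        simp only [hX, MeasurableEquiv.piEquivPiSubtypeProd, Equiv.piEquivPiSubtypeProd,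
          MeasurableEquiv.symm_mk, MeasurableEquiv.coe_mk, Equiv.coe_fn_symm_mk]
        rw [dif_neg this]
      rw [hXi, hXj] at hz
      -- The edge between i and j counts in both degrees or in neither, so it cancels from the
      -- comparison.
      have hs : (x2 ∈ B x1) = (x1 ∈ B x2) := propext ⟨hsymm _ _, hsymm _ _⟩
      simp only [hs, add_le_add_iff_left] at hz
      have e : (Finset.univ.filter fun l : {l // ¬ (l = j ∨ l = i)} => X l ∈ B x2).card =
          (Finset.univ.filter fun l : {l // ¬ (l = i ∨ l = j)} => X l ∈ B x2).card := by
        refine Finset.card_equiv (Equiv.subtypeEquivRight fun l => by rw [or_comm]) fun l => ?_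
        simp
      rw [e] at hz
      simp only [hXl] at hz
      exact hz
    · congr 1; ring
  · have : {z | (MeasurableEquiv.piEquivPiSubtypeProd (fun _ => E)
        fun l => l = i ∨ l = j).symm (y, z) ∈ {X : Fin n → E | rad (X i) ≤ M ∧
          rad (X i) + η < rad (X j) ∧ neighborCount B X i ≤ neighborCount B X j}} = ∅ := by
      rw [Set.eq_empty_iff_forall_notMem]
      rintro z ⟨h1, h2, -⟩
      refine hr ⟨?_, ?_⟩
      · simpa [MeasurableEquiv.piEquivPiSubtypeProd, Equiv.piEquivPiSubtypeProd] using h1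
      · simpa [MeasurableEquiv.piEquivPiSubtypeProd, Equiv.piEquivPiSubtypeProd] using h2
    rw [this, measureReal_empty]
    exact (Real.exp_pos _).le

/-- It is unlikely that one point has radius at most `M` and the radius of another one is larger
by at most `η`. -/
theorem pi_real_radius_window_le {E : Type*} [MeasurableSpace E] (μ : Measure E)
    [IsProbabilityMeasure μ] {rad : E → ℝ} (hrad : Measurable rad) {M η w : ℝ}
    (hwin : ∀ x, rad x ≤ M → μ.real {y | rad x ≤ rad y ∧ rad y ≤ rad x + η} ≤ w)
    {n : ℕ} {i j : Fin n} (hij : i ≠ j) :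
    (Measure.pi fun _ : Fin n => μ).real {X | rad (X i) ≤ M ∧ rad (X i) ≤ rad (X j) ∧
      rad (X j) ≤ rad (X i) + η} ≤ μ.real {x | rad x ≤ M} * w := by
  have hS : MeasurableSet {p : E × E | rad p.1 ≤ M ∧ rad p.1 ≤ rad p.2 ∧ rad p.2 ≤ rad p.1 + η} :=
    (measurableSet_le (hrad.comp measurable_fst) measurable_const).inter
      ((measurableSet_le (hrad.comp measurable_fst) (hrad.comp measurable_snd)).inter
        (measurableSet_le (hrad.comp measurable_snd)
          ((hrad.comp measurable_fst).add measurable_const)))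
  have hA : MeasurableSet {x | rad x ≤ M} := measurableSet_le hrad measurable_const
  have h := pi_real_pair μ hij hS
  refine h.le.trans ?_
  -- The sign of w is only known through `hwin`, which is vacuous when no point has radius at most
  -- M; the events are then empty.
  by_cases hne : ∃ x, rad x ≤ M
  · obtain ⟨x0, hx0⟩ := hne
    have hw : 0 ≤ w := measureReal_nonneg.trans (hwin x0 hx0)
    rw [measureReal_def, Measure.prod_apply hS]
    refine ENNReal.toReal_le_of_le_ofReal (mul_nonneg measureReal_nonneg hw) ?_
    calc _ ≤ ∫⁻ x, Set.indicator {x | rad x ≤ M} (fun _ => ENNReal.ofReal w) x ∂μ := by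
          refine lintegral_mono fun x => ?_
          by_cases hx : rad x ≤ M
          · rw [Set.indicator_of_mem (by exact hx), ← ENNReal.ofReal_toReal (measure_ne_top _ _)]
            refine ENNReal.ofReal_le_ofReal (le_trans (le_of_eq ?_) (hwin x hx))
            rw [measureReal_def]
            congr 2
            ext y; simp [hx]
          · have : Prod.mk x ⁻¹' {p : E × E | rad p.1 ≤ M ∧ rad p.1 ≤ rad p.2 ∧
                rad p.2 ≤ rad p.1 + η} = ∅ := by
              ext y; simp [hx]
            simp [this]
      _ = _ := by
          rw [lintegral_indicator hA, lintegral_const, Measure.restrict_apply_univ, mul_comm,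
            ENNReal.ofReal_mul measureReal_nonneg, ofReal_measureReal]
  · have h1 : {p : E × E | rad p.1 ≤ M ∧ rad p.1 ≤ rad p.2 ∧ rad p.2 ≤ rad p.1 + η} = ∅ := by
      ext p; simp only [Set.mem_ofPred_eq, Set.mem_empty_iff_false, iff_false]
      exact fun hp => hne ⟨_, hp.1⟩
    have h2 : {x | rad x ≤ M} = ∅ := by
      ext x; simp only [Set.mem_ofPred_eq, Set.mem_empty_iff_false, iff_false]
      exact fun hx => hne ⟨_, hx⟩
    rw [h1, h2]; simp

/-- The `k` points of smallest radius have decreasing numbers of neighbours, which exceed those of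
the other points, except on an event of small probability. -/
theorem pi_real_not_ordered_le {E : Type*} [MeasurableSpace E] (μ : Measure E)
    [IsProbabilityMeasure μ] {rad : E → ℝ} (hrad : Measurable rad) {B : E → Set E}
    (hB : MeasurableSet {p : E × E | p.2 ∈ B p.1}) (hsymm : ∀ x y, y ∈ B x → x ∈ B y)
    {M η ε w : ℝ} (hε : 0 < ε)
    (hgap : ∀ x y, rad x ≤ M → rad x + η < rad y → √(μ.real (B y)) + ε ≤ √(μ.real (B x)))
    (hwin : ∀ x, rad x ≤ M → μ.real {y | rad x ≤ rad y ∧ rad y ≤ rad x + η} ≤ w)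
    (n k : ℕ) :
    (Measure.pi fun _ : Fin n => μ).real {X | ¬ ∀ σ : Equiv.Perm (Fin n),
      Monotone (fun i => rad (X (σ i))) → ∀ i j : Fin n, i < j → (i : ℕ) < k →
        neighborCount B X (σ j) < neighborCount B X (σ i)} ≤
      2 ^ k * Real.exp (-(n * μ.real {x | rad x ≤ M} / 2)) +
      (n : ℝ) ^ 2 * (μ.real {x | rad x ≤ M} * w) +
      (n : ℝ) ^ 2 * Real.exp (-(((n : ℝ) - 2) * ε ^ 2 / 4)) := by
  classical
  set P := Measure.pi fun _ : Fin n => μ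
  set few : Set (Fin n → E) :=
    {X | (Finset.univ.filter fun l => X l ∈ {x | rad x ≤ M}).card < k}
  set win : Fin n × Fin n → Set (Fin n → E) := fun q =>
    {X | rad (X q.1) ≤ M ∧ rad (X q.1) ≤ rad (X q.2) ∧ rad (X q.2) ≤ rad (X q.1) + η}
  set dev : Fin n × Fin n → Set (Fin n → E) := fun q =>
    {X | rad (X q.1) ≤ M ∧ rad (X q.1) + η < rad (X q.2) ∧
      neighborCount B X q.1 ≤ neighborCount B X q.2}
  set D : Finset (Fin n × Fin n) := Finset.univ.offDiag
  have hD : (D.card : ℝ) ≤ (n : ℝ) ^ 2 := by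
    have : D.card ≤ n ^ 2 := by
      rw [Finset.offDiag_card, Finset.card_univ, Fintype.card_fin, sq]
      exact Nat.sub_le _ _
    exact_mod_cast this
  have hsub : {X : Fin n → E | ¬ ∀ σ : Equiv.Perm (Fin n),
      Monotone (fun i => rad (X (σ i))) → ∀ i j : Fin n, i < j → (i : ℕ) < k →
        neighborCount B X (σ j) < neighborCount B X (σ i)} ⊆
      (few ∪ ⋃ q ∈ D, win q) ∪ ⋃ q ∈ D, dev q := by
    intro X hX
    by_contra hcon
    simp only [Set.mem_union, Set.mem_iUnion, not_or, not_exists] at hcon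
    obtain ⟨⟨h1, h2⟩, h3⟩ := hcon
    refine hX fun σ hσ i j hij hik => ?_
    have hne : (σ i, σ j) ∈ D := by
      simp [D, Finset.mem_offDiag, hij.ne]
    -- Otherwise every node of radius at most M sits at a position before i, and there are fewer
    -- than k such positions.
    have hM : rad (X (σ i)) ≤ M := by
      by_contra hM
      apply h1
      calc (Finset.univ.filter fun l => X l ∈ {x | rad x ≤ M}).card
          ≤ ((Finset.univ.filter fun l : Fin n => l < i).image σ).card := by
            refine Finset.card_le_card fun l hl => ?_
            rw [Finset.mem_image]
            refine ⟨σ.symm l, ?_, by simp⟩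
            simp only [Finset.mem_filter, Finset.mem_univ, true_and, Set.mem_ofPred_eq] at hl ⊢
            by_contra hlt
            have := hσ (not_lt.1 hlt)
            simp only [Equiv.apply_symm_apply] at this
            linarith
        _ ≤ (Finset.univ.filter fun l : Fin n => l < i).card := Finset.card_image_le
        _ = i := by
            rw [Finset.filter_gt_eq_Iio, Fin.card_Iio]
        _ < k := hik
    have hle : rad (X (σ i)) ≤ rad (X (σ j)) := hσ hij.le
    have hη : rad (X (σ i)) + η < rad (X (σ j)) := by
      by_contra hη
      exact h2 _ hne ⟨hM, hle, not_lt.1 hη⟩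
    by_contra hdeg
    exact h3 _ hne ⟨hM, hη, not_lt.1 hdeg⟩
  refine (measureReal_mono hsub (measure_ne_top _ _)).trans
    ((measureReal_union_le _ _).trans (add_le_add ((measureReal_union_le _ _).trans
      (add_le_add ?_ ?_)) ?_))
  · have := pi_real_card_lt_le (ι := Fin n) μ (A := {x | rad x ≤ M})
      (measurableSet_le hrad measurable_const) k
    rwa [Fintype.card_fin] at this
  · refine (measureReal_biUnion_finset_le _ _).trans ?_
    refine (Finset.sum_le_card_nsmul _ _ (μ.real {x | rad x ≤ M} * w) fun q hq => ?_).trans ?_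
    · exact pi_real_radius_window_le μ hrad hwin (Finset.mem_offDiag.1 hq).2.2
    · rw [nsmul_eq_mul]
      by_cases hne : ∃ x, rad x ≤ M
      · obtain ⟨x0, hx0⟩ := hne
        have hw : 0 ≤ w := measureReal_nonneg.trans (hwin x0 hx0)
        exact mul_le_mul_of_nonneg_right hD (mul_nonneg measureReal_nonneg hw)
      · have h2 : {x | rad x ≤ M} = ∅ := by
          ext x; simp only [Set.mem_ofPred_eq, Set.mem_empty_iff_false, iff_false]
          exact fun hx => hne ⟨_, hx⟩
        rw [h2]; simp
  · refine (measureReal_biUnion_finset_le _ _).trans ?_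
    refine (Finset.sum_le_card_nsmul _ _ (Real.exp (-(((n : ℝ) - 2) * ε ^ 2 / 4)))
      fun q hq => ?_).trans ?_
    · exact pi_real_neighborCount_le μ hrad hB hsymm hε hgap (Finset.mem_offDiag.1 hq).2.2
    · rw [nsmul_eq_mul]
      exact mul_le_mul_of_nonneg_right hD (Real.exp_pos _).le

end Neighbourhoods

/-! ### Hyperbolic distance in polar coordinates. -/

noncomputable section

namespace RHG

open Complex.UnitDisc

/-- The hyperbolic cosine of the distance of two points with radii `r` and `t`, where `κ` is the
cosine of the difference of their angles. -/
def coshDist (r t κ : ℝ) : ℝ := Real.cosh r * Real.cosh t - κ * (Real.sinh r * Real.sinh t)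

theorem hypDist_le_iff (z w : 𝔻) {ρ : ℝ} (hρ : 0 ≤ ρ) :
    hypDist z w ≤ ρ ↔ ‖(z : ℂ) - (w : ℂ)‖ ^ 2 ≤
      Real.sinh (ρ / 2) ^ 2 * ((1 - ‖(z : ℂ)‖ ^ 2) * (1 - ‖(w : ℂ)‖ ^ 2)) := by
  have hD : 0 < (1 - ‖(z : ℂ)‖ ^ 2) * (1 - ‖(w : ℂ)‖ ^ 2) :=
    mul_pos (sub_pos.2 z.sq_norm_lt_one) (sub_pos.2 w.sq_norm_lt_one)
  have hS : 0 ≤ Real.sinh (ρ / 2) := Real.sinh_nonneg_iff.2 (by linarith)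
  have h1 : hypDist z w ≤ ρ ↔
      ‖(z : ℂ) - (w : ℂ)‖ / √((1 - ‖(z : ℂ)‖ ^ 2) * (1 - ‖(w : ℂ)‖ ^ 2)) ≤ Real.sinh (ρ / 2) := by
    rw [hypDist, ← Real.arsinh_le_arsinh (y := Real.sinh (ρ / 2)), Real.arsinh_sinh]
    constructor <;> intro h <;> linarith
  rw [h1, div_le_iff₀ (Real.sqrt_pos.2 hD), ← sq_le_sq₀ (norm_nonneg _) (by positivity), mul_pow,
    Real.sq_sqrt hD.le]

theorem norm_polar_sq (r θ : ℝ) : ‖(polar (r, θ) : ℂ)‖ ^ 2 = Real.tanh (r / 2) ^ 2 := by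
  rw [polar, coe_mk, norm_mul, Complex.norm_exp_ofReal_mul_I, mul_one, Complex.norm_real,
    Real.norm_eq_abs, sq_abs]

theorem norm_polar_sub_polar_sq (r θ t φ : ℝ) :
    ‖(polar (r, θ) : ℂ) - (polar (t, φ) : ℂ)‖ ^ 2 = Real.tanh (r / 2) ^ 2 + Real.tanh (t / 2) ^ 2 -
      2 * (Real.tanh (r / 2) * Real.tanh (t / 2)) * Real.cos (θ - φ) := by
  rw [polar, polar, coe_mk, coe_mk, ← Complex.normSq_eq_norm_sq, Complex.normSq_apply]
  simp only [Complex.sub_re, Complex.sub_im, Complex.re_ofReal_mul, Complex.im_ofReal_mul,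
    Complex.exp_ofReal_mul_I_re, Complex.exp_ofReal_mul_I_im, Real.cos_sub]
  have h1 := Real.sin_sq_add_cos_sq θ
  have h2 := Real.sin_sq_add_cos_sq φ
  linear_combination Real.tanh (r / 2) ^ 2 * h1 + Real.tanh (t / 2) ^ 2 * h2

/-- The hyperbolic law of cosines: half-angle formulas turn the Euclidean expression for the
distance into `coshDist`, after clearing the denominators cosh²(r/2) cosh²(t/2). -/
theorem hypDist_polar_le_iff (r θ t φ : ℝ) {ρ : ℝ} (hρ : 0 ≤ ρ) :
    hypDist (polar (r, θ)) (polar (t, φ)) ≤ ρ ↔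
      coshDist r t (Real.cos (θ - φ)) ≤ Real.cosh ρ := by
  rw [hypDist_le_iff _ _ hρ, norm_polar_sub_polar_sq, norm_polar_sq, norm_polar_sq, coshDist]
  have hr := Real.cosh_pos (r / 2)
  have ht := Real.cosh_pos (t / 2)
  have e1 := Real.cosh_sq (r / 2)
  have e2 := Real.cosh_sq (t / 2)
  have er : Real.cosh r = 2 * Real.sinh (r / 2) ^ 2 + 1 := by
    rw [show r = 2 * (r / 2) by ring, Real.cosh_two_mul, e1]; ring_nf
  have et : Real.cosh t = 2 * Real.sinh (t / 2) ^ 2 + 1 := by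
    rw [show t = 2 * (t / 2) by ring, Real.cosh_two_mul, e2]; ring_nf
  have eρ : Real.cosh ρ = 2 * Real.sinh (ρ / 2) ^ 2 + 1 := by
    rw [show ρ = 2 * (ρ / 2) by ring, Real.cosh_two_mul, Real.cosh_sq]; ring_nf
  have fr : Real.sinh r = 2 * Real.sinh (r / 2) * Real.cosh (r / 2) := by
    rw [show r = 2 * (r / 2) by ring, Real.sinh_two_mul]; ring_nf
  have ft : Real.sinh t = 2 * Real.sinh (t / 2) * Real.cosh (t / 2) := by
    rw [show t = 2 * (t / 2) by ring, Real.sinh_two_mul]; ring_nf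
  rw [er, et, eρ, fr, ft, Real.tanh_eq_sinh_div_cosh, Real.tanh_eq_sinh_div_cosh]
  set a := Real.sinh (r / 2)
  set b := Real.sinh (t / 2)
  set A := Real.cosh (r / 2)
  set B := Real.cosh (t / 2)
  set c := Real.cos (θ - φ)
  set S := Real.sinh (ρ / 2)
  have hAB : 0 < A ^ 2 * B ^ 2 := by positivity
  rw [← mul_le_mul_iff_left₀ hAB]
  have l1 : ((a / A) ^ 2 + (b / B) ^ 2 - 2 * (a / A * (b / B)) * c) * (A ^ 2 * B ^ 2) =
      a ^ 2 * B ^ 2 + b ^ 2 * A ^ 2 - 2 * (a * A * (b * B)) * c := by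
    field_simp
  have l2 : S ^ 2 * ((1 - (a / A) ^ 2) * (1 - (b / B) ^ 2)) * (A ^ 2 * B ^ 2) = S ^ 2 := by
    have : S ^ 2 * ((1 - (a / A) ^ 2) * (1 - (b / B) ^ 2)) * (A ^ 2 * B ^ 2) =
        S ^ 2 * ((A ^ 2 - a ^ 2) * (B ^ 2 - b ^ 2)) := by field_simp
    rw [this, e1, e2]; ring
  rw [l1, l2, e1, e2]
  constructor <;> intro h <;> nlinarith

theorem radius_polar {r : ℝ} (hr : 0 ≤ r) (θ : ℝ) : radius (polar (r, θ)) = r := by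
  have h0 : ((0 : 𝔻) : ℂ) = 0 := rfl
  have hn : ‖(polar (r, θ) : ℂ)‖ = Real.tanh (r / 2) := by
    rw [← Real.sqrt_sq (norm_nonneg _), norm_polar_sq, Real.sqrt_sq]
    rw [Real.tanh_eq_sinh_div_cosh]
    exact div_nonneg (Real.sinh_nonneg_iff.2 (by linarith)) (Real.cosh_pos _).le
  have hc := Real.cosh_pos (r / 2)
  have h1 : 1 - Real.tanh (r / 2) ^ 2 = (1 / Real.cosh (r / 2)) ^ 2 := by
    rw [Real.tanh_eq_sinh_div_cosh]
    field_simp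
    rw [Real.cosh_sq]; ring
  rw [radius, hypDist, h0, zero_sub, norm_neg, norm_zero, hn, sq, mul_zero, sub_zero, one_mul, h1,
    Real.sqrt_sq (by positivity), Real.tanh_eq_sinh_div_cosh]
  rw [show Real.sinh (r / 2) / Real.cosh (r / 2) / (1 / Real.cosh (r / 2)) = Real.sinh (r / 2) by
    field_simp, Real.arsinh_sinh]
  ring

theorem radius_nonneg (z : 𝔻) : 0 ≤ radius z := by
  rw [radius, hypDist]
  have := Real.arsinh_nonneg_iff.2 (show (0 : ℝ) ≤ ‖((0 : 𝔻) : ℂ) - (z : ℂ)‖ /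
    √((1 - ‖((0 : 𝔻) : ℂ)‖ ^ 2) * (1 - ‖(z : ℂ)‖ ^ 2)) by positivity)
  linarith

theorem polar_radius_arg (z : 𝔻) : polar (radius z, Complex.arg z) = z := by
  apply coe_injective
  have h0 : ((0 : 𝔻) : ℂ) = 0 := rfl
  have hz : 0 < 1 - ‖(z : ℂ)‖ ^ 2 := sub_pos.2 z.sq_norm_lt_one
  have ht : Real.tanh (radius z / 2) = ‖(z : ℂ)‖ := by
    rw [radius, hypDist, h0, zero_sub, norm_neg, norm_zero, sq, mul_zero, sub_zero, one_mul,
      mul_div_cancel_left₀ _ two_ne_zero, Real.tanh_eq_sinh_div_cosh, Real.sinh_arsinh,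
      Real.cosh_arsinh, div_pow, Real.sq_sqrt hz.le]
    have : 1 + ‖(z : ℂ)‖ ^ 2 / (1 - ‖(z : ℂ)‖ ^ 2) = 1 / (1 - ‖(z : ℂ)‖ ^ 2) := by
      field_simp; ring
    rw [this, Real.sqrt_div zero_le_one, Real.sqrt_one]
    have := Real.sqrt_pos.2 hz
    field_simp
  rw [polar, coe_mk, ht]
  exact Complex.norm_mul_exp_arg_mul_I z

theorem measurable_polar : Measurable polar := by
  refine Continuous.measurable (isEmbedding_coe.continuous_iff.2 ?_)
  have h1 : Continuous fun p : ℝ × ℝ => Real.tanh (p.1 / 2) := by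
    simp only [Real.tanh_eq_sinh_div_cosh]
    exact (Real.continuous_sinh.comp (by fun_prop)).div (Real.continuous_cosh.comp (by fun_prop))
      fun p => (Real.cosh_pos _).ne'
  exact (Complex.continuous_ofReal.comp h1).mul (by fun_prop)

theorem measurable_hypDist : Measurable fun p : 𝔻 × 𝔻 => hypDist p.1 p.2 := by
  have hc : Measurable fun z : 𝔻 => (z : ℂ) := continuous_coe.measurable
  have h1 : Measurable fun p : 𝔻 × 𝔻 => (p.1 : ℂ) := hc.comp measurable_fst
  have h2 : Measurable fun p : 𝔻 × 𝔻 => (p.2 : ℂ) := hc.comp measurable_snd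
  have hF : Measurable fun q : ℂ × ℂ =>
      ‖q.1 - q.2‖ / √((1 - ‖q.1‖ ^ 2) * (1 - ‖q.2‖ ^ 2)) := by fun_prop
  have hG := (Real.continuous_arsinh.measurable.comp (hF.comp (h1.prodMk h2))).const_mul 2
  exact hG

theorem measurable_radius : Measurable radius := by
  have h := measurable_hypDist.comp ((measurable_const (a := (0 : 𝔻))).prodMk measurable_id)
  exact h

/-- Convexity of hyperbolic balls along a ray from a point of the ball. -/
theorem coshDist_le_of_le {r t s κ c : ℝ} (ht0 : 0 ≤ t) (hts : t ≤ s)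
    (hr : Real.cosh r ≤ c) (hs : coshDist r s κ ≤ c) : coshDist r t κ ≤ c := by
  have hc : 0 < c := (Real.cosh_pos r).trans_le hr
  rcases hts.eq_or_lt with rfl | hlt
  · exact hs
  have hs0 : 0 < Real.sinh s := Real.sinh_pos_iff.2 (by linarith)
  have hu0 : 0 ≤ Real.sinh (s - t) := Real.sinh_nonneg_iff.2 (by linarith)
  have ht0' : 0 ≤ Real.sinh t := Real.sinh_nonneg_iff.2 ht0
  -- In t, `coshDist` is a combination of cosh t and sinh t, hence determined by its values at 0
  -- (which is cosh r) and at s. The interpolation weights sum to at most sinh s.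
  have key : Real.sinh s * coshDist r t κ =
      Real.sinh (s - t) * Real.cosh r + Real.sinh t * coshDist r s κ := by
    rw [coshDist, coshDist, Real.sinh_sub]; ring
  have hadd : Real.sinh (s - t) + Real.sinh t ≤ Real.sinh s := by
    have h1 : Real.sinh s = Real.sinh (s - t) * Real.cosh t + Real.cosh (s - t) * Real.sinh t := by
      rw [← Real.sinh_add]; ring_nf
    rw [h1]
    have := Real.one_le_cosh t
    have := Real.one_le_cosh (s - t)
    nlinarith
  have h2 : Real.sinh s * coshDist r t κ ≤ Real.sinh s * c := by
    rw [key]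
    nlinarith [mul_le_mul_of_nonneg_left hr hu0, mul_le_mul_of_nonneg_left hs ht0']
  exact le_of_mul_le_mul_left h2 hs0

theorem coshDist_comm (r t κ : ℝ) : coshDist r t κ = coshDist t r κ := by
  rw [coshDist, coshDist]; ring

/-! ### The angular, radial and node laws. -/

instance isProbabilityMeasure_angularLaw : IsProbabilityMeasure angularLaw := by
  refine cond_isProbabilityMeasure_of_finite ?_ ?_
  · simp [Real.pi_pos]
  · simp

theorem angularLaw_real_eq {S : Set ℝ} (hS : MeasurableSet S) :
    angularLaw.real S = (2 * Real.pi)⁻¹ * ∫ x in -Real.pi..Real.pi, S.indicator (fun _ => 1) x := by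
  have hpi := Real.pi_pos
  rw [angularLaw, measureReal_def, cond_apply measurableSet_Ioc, ENNReal.toReal_mul,
    ENNReal.toReal_inv, ← measureReal_def, ← measureReal_def, Real.volume_real_Ioc_of_le (by linarith),
    intervalIntegral.integral_of_le (by linarith), integral_indicator hS,
    setIntegral_const, measureReal_restrict_apply hS, smul_eq_mul, mul_one, Set.inter_comm]
  congr 2; ring

/-- Rotation invariance, by 2π-periodicity of the cosine; it is what makes the mass of a ball depend
only on the radius of its centre. -/
theorem angularLaw_real_rotation (U : Set ℝ) (hU : MeasurableSet U) (θ : ℝ) :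
    angularLaw.real {φ | Real.cos (θ - φ) ∈ U} = angularLaw.real {φ | Real.cos φ ∈ U} := by
  have hm1 : MeasurableSet {φ | Real.cos φ ∈ U} := Real.measurable_cos hU
  have hm2 : MeasurableSet {φ | Real.cos (θ - φ) ∈ U} :=
    (Real.measurable_cos.comp (measurable_const.sub measurable_id)) hU
  rw [angularLaw_real_eq hm1, angularLaw_real_eq hm2]
  congr 1
  have hper : Function.Periodic (Set.indicator {φ | Real.cos φ ∈ U} fun _ : ℝ => (1 : ℝ))
      (2 * Real.pi) := fun x => by
    by_cases h : Real.cos x ∈ U <;> simp [h]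
  have h1 := intervalIntegral.integral_comp_sub_left
    (f := Set.indicator {φ | Real.cos φ ∈ U} fun _ : ℝ => (1 : ℝ)) (a := -Real.pi) (b := Real.pi) θ
  have h2 := hper.intervalIntegral_add_eq (θ - Real.pi) (-Real.pi)
  rw [show θ - Real.pi + 2 * Real.pi = θ - -Real.pi by ring,
    show -Real.pi + 2 * Real.pi = Real.pi by ring] at h2
  rw [← h2, ← h1]
  rfl

theorem one_lt_cosh_mul_R {α ν : ℝ} {n : ℕ} (hα : 0 < α) (hR : 0 < R ν n) :
    1 < Real.cosh (α * R ν n) :=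
  Real.one_lt_cosh.2 (mul_pos hα hR).ne'

theorem measurable_radialDensity (α ν : ℝ) (n : ℕ) : Measurable (radialDensity α ν n) := by
  refine Measurable.indicator ?_ measurableSet_Ico
  exact (((Real.continuous_sinh.comp (continuous_const.mul continuous_id)).const_smul
    α).div_const _).measurable

theorem radialLaw_apply {α ν : ℝ} {n : ℕ} {S : Set ℝ} (hS : MeasurableSet S) :
    radialLaw α ν n S = ∫⁻ t in S, ENNReal.ofReal (radialDensity α ν n t) :=
  withDensity_apply _ hS

theorem radialLaw_Ico {α ν : ℝ} {n : ℕ} (hα : 0 < α) (hR : 0 < R ν n) {b : ℝ} (hb : 0 ≤ b)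
    (hbR : b ≤ R ν n) : radialLaw α ν n (Set.Ico 0 b) =
      ENNReal.ofReal ((Real.cosh (α * b) - 1) / (Real.cosh (α * R ν n) - 1)) := by
  set Z := Real.cosh (α * R ν n) - 1 with hZ
  have hZ0 : 0 < Z := sub_pos.2 (one_lt_cosh_mul_R hα hR)
  rw [radialLaw_apply measurableSet_Ico]
  have h1 : ∫⁻ t in Set.Ico 0 b, ENNReal.ofReal (radialDensity α ν n t) =
      ∫⁻ t in Set.Ico 0 b, ENNReal.ofReal (α * Real.sinh (α * t) / Z) := by
    refine setLIntegral_congr_fun measurableSet_Ico fun t ht => ?_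
    have : t ∈ Set.Ico 0 (R ν n) := ⟨ht.1, ht.2.trans_le hbR⟩
    simp only [radialDensity, Set.indicator_of_mem this, ← hZ]
  have hcont : Continuous fun t : ℝ => α * Real.sinh (α * t) / Z := by fun_prop
  rw [h1, ← ofReal_integral_eq_lintegral_ofReal]
  · congr 1
    rw [integral_Ico_eq_integral_Ioc, ← intervalIntegral.integral_of_le hb,
      intervalIntegral.integral_eq_sub_of_hasDerivAt (f := fun t => Real.cosh (α * t) / Z)]
    · simp only [mul_zero, Real.cosh_zero]; ring
    · intro t _
      have := ((Real.hasDerivAt_cosh (α * t)).comp t ((hasDerivAt_id t).const_mul α)).div_const Z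
      exact this.congr_deriv (by ring)
    · exact hcont.intervalIntegrable _ _
  · exact (hcont.integrableOn_Icc).mono_set Set.Ico_subset_Icc_self
  · refine (ae_restrict_iff' measurableSet_Ico).2 (ae_of_all _ fun t ht => ?_)
    have := Real.sinh_nonneg_iff.2 (mul_nonneg hα.le ht.1)
    positivity

theorem ae_radialLaw_mem_Ico (α ν : ℝ) (n : ℕ) :
    ∀ᵐ t ∂(radialLaw α ν n), t ∈ Set.Ico 0 (R ν n) := by
  rw [ae_iff]
  change radialLaw α ν n (Set.Ico 0 (R ν n))ᶜ = 0
  rw [radialLaw_apply measurableSet_Ico.compl,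
    setLIntegral_congr_fun (g := fun _ => 0) measurableSet_Ico.compl fun t ht => ?_]
  · simp
  · simp [radialDensity, Set.indicator_of_notMem ht]

theorem isProbabilityMeasure_radialLaw {α ν : ℝ} {n : ℕ} (hα : 0 < α) (hR : 0 < R ν n) :
    IsProbabilityMeasure (radialLaw α ν n) := by
  constructor
  have h1 : radialLaw α ν n Set.univ = radialLaw α ν n (Set.Ico 0 (R ν n)) := by
    refine measure_congr ?_
    filter_upwards [ae_radialLaw_mem_Ico α ν n] with t ht
    exact propext ⟨fun _ => ht, fun _ => trivial⟩
  have hZ0 : 0 < Real.cosh (α * R ν n) - 1 := sub_pos.2 (one_lt_cosh_mul_R hα hR)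
  rw [h1, radialLaw_Ico hα hR hR.le le_rfl, div_self hZ0.ne', ENNReal.ofReal_one]

theorem radialLaw_real_Iic {α ν : ℝ} {n : ℕ} (hα : 0 < α) (hR : 0 < R ν n) {M : ℝ} (hM : 0 ≤ M)
    (hMR : M < R ν n) : (radialLaw α ν n).real (Set.Iic M) =
      (Real.cosh (α * M) - 1) / (Real.cosh (α * R ν n) - 1) := by
  have hZ0 : 0 < Real.cosh (α * R ν n) - 1 := sub_pos.2 (one_lt_cosh_mul_R hα hR)
  have h1 : radialLaw α ν n (Set.Iic M) = radialLaw α ν n (Set.Ico 0 M) := by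
    refine measure_congr ?_
    have h2 : ∀ᵐ t ∂(radialLaw α ν n), t ≠ M :=
      (withDensity_absolutelyContinuous _ _).ae_le (volume.ae_ne M)
    filter_upwards [ae_radialLaw_mem_Ico α ν n, h2] with t ht htM
    refine propext ⟨fun h => ⟨ht.1, lt_of_le_of_ne h htM⟩, fun h => h.2.le⟩
  rw [measureReal_def, h1, radialLaw_Ico hα hR hM hMR.le, ENNReal.toReal_ofReal]
  exact div_nonneg (sub_nonneg.2 (Real.one_le_cosh _)) hZ0.le

theorem radialLaw_real_Icc_le {α ν : ℝ} {n : ℕ} (hα : 0 < α) (hR : 0 < R ν n) {r η : ℝ}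
    (hr : 0 ≤ r) (hη : 0 ≤ η) : (radialLaw α ν n).real (Set.Icc r (r + η)) ≤
      α * Real.sinh (α * (r + η)) / (Real.cosh (α * R ν n) - 1) * η := by
  have hZ0 : 0 < Real.cosh (α * R ν n) - 1 := sub_pos.2 (one_lt_cosh_mul_R hα hR)
  have hs : 0 ≤ Real.sinh (α * (r + η)) := Real.sinh_nonneg_iff.2 (by positivity)
  refine ENNReal.toReal_le_of_le_ofReal (by positivity) ?_
  rw [radialLaw_apply measurableSet_Icc]
  calc _ ≤ ∫⁻ _t in Set.Icc r (r + η),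
        ENNReal.ofReal (α * Real.sinh (α * (r + η)) / (Real.cosh (α * R ν n) - 1)) := by
        refine setLIntegral_mono measurable_const fun t ht => ENNReal.ofReal_le_ofReal ?_
        unfold radialDensity
        by_cases h : t ∈ Set.Ico 0 (R ν n)
        · rw [Set.indicator_of_mem h]
          have : Real.sinh (α * t) ≤ Real.sinh (α * (r + η)) :=
            Real.sinh_le_sinh.2 (mul_le_mul_of_nonneg_left ht.2 hα.le)
          gcongr
        · rw [Set.indicator_of_notMem h]; positivity
    _ = _ := by
        rw [setLIntegral_const, Real.volume_Icc, ← ENNReal.ofReal_mul (by positivity)]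
        congr 2; ring

/-- Within distance 3 of the rim the density is at least α e^(-3α)/4, uniformly in n. The 1/α in the
hypothesis makes α(R - 3) ≥ 1, so that sinh is comparable to exp there. -/
theorem le_radialLaw_Ioo {α ν : ℝ} {n : ℕ} (hα : 0 < α) (hR : 3 + 1 / α ≤ R ν n) {a b : ℝ}
    (ha : R ν n - 3 ≤ a) (hb : b ≤ R ν n) :
    ENNReal.ofReal (α * Real.exp (-(3 * α)) / 4 * (b - a)) ≤ radialLaw α ν n (Set.Ioo a b) := by
  have hα' : 0 < 1 / α := by positivity
  have hRp : 0 < R ν n := by linarith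
  have hZ0 : 0 < Real.cosh (α * R ν n) - 1 := sub_pos.2 (one_lt_cosh_mul_R hα hRp)
  rw [radialLaw_apply measurableSet_Ioo]
  calc _ = ∫⁻ _t in Set.Ioo a b, ENNReal.ofReal (α * Real.exp (-(3 * α)) / 4) := by
        rw [setLIntegral_const, Real.volume_Ioo, ← ENNReal.ofReal_mul (by positivity)]
    _ ≤ _ := by
        refine setLIntegral_mono (measurable_radialDensity α ν n).ennreal_ofReal
          fun t ht => ENNReal.ofReal_le_ofReal ?_
        have h : t ∈ Set.Ico 0 (R ν n) := ⟨by linarith [ht.1], by linarith [ht.2]⟩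
        rw [radialDensity, Set.indicator_of_mem h, le_div_iff₀ hZ0]
        have hx : 1 ≤ α * (R ν n - 3) := by
          have : α * (1 / α) = 1 := by field_simp
          nlinarith
        have h1 : Real.sinh (α * (R ν n - 3)) ≤ Real.sinh (α * t) :=
          Real.sinh_le_sinh.2 (mul_le_mul_of_nonneg_left (by linarith [ht.1]) hα.le)
        have h2 : Real.exp (α * (R ν n - 3)) / 4 ≤ Real.sinh (α * (R ν n - 3)) := by
          rw [Real.sinh_eq]
          have e1 : 2 ≤ Real.exp (α * (R ν n - 3)) := by
            have := Real.add_one_le_exp (α * (R ν n - 3)); linarith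
          have e2 : Real.exp (-(α * (R ν n - 3))) ≤ 1 := Real.exp_le_one_iff.2 (by linarith)
          linarith
        have h3 : Real.cosh (α * R ν n) ≤ Real.exp (α * R ν n) := by
          rw [Real.cosh_eq]
          have : Real.exp (-(α * R ν n)) ≤ Real.exp (α * R ν n) :=
            Real.exp_le_exp.2 (by have := mul_pos hα hRp; linarith)
          linarith
        have h4 : Real.exp (-(3 * α)) * Real.exp (α * R ν n) = Real.exp (α * (R ν n - 3)) := by
          rw [← Real.exp_add]; ring_nf
        calc α * Real.exp (-(3 * α)) / 4 * (Real.cosh (α * R ν n) - 1)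
            ≤ α * Real.exp (-(3 * α)) / 4 * Real.exp (α * R ν n) := by gcongr; linarith
          _ = α * (Real.exp (α * (R ν n - 3)) / 4) := by rw [← h4]; ring
          _ ≤ α * Real.sinh (α * t) := by gcongr; linarith

/-- The density is at most 2α e^(α(t-R)), so the integrand is at most 2α e^((α-1/2)(t-R)). The
integral stays bounded in n because α > 1/2. -/
theorem lintegral_exp_radialLaw_le {α ν : ℝ} {n : ℕ} (hα : 1 / 2 < α)
    (hR : 4 ≤ Real.exp (α * R ν n)) (hR0 : 0 < R ν n) :
    ∫⁻ t, ENNReal.ofReal (Real.exp ((R ν n - t) / 2)) ∂(radialLaw α ν n) ≤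
      ENNReal.ofReal (2 * α / (α - 1 / 2)) := by
  have hα0 : 0 < α := by linarith
  set β := α - 1 / 2 with hβ
  have hβ0 : 0 < β := by linarith
  set ρ := R ν n with hρ
  have hZ0 : 0 < Real.cosh (α * ρ) - 1 := sub_pos.2 (one_lt_cosh_mul_R hα0 hR0)
  rw [radialLaw, lintegral_withDensity_eq_lintegral_mul _
    (measurable_radialDensity α ν n).ennreal_ofReal (by fun_prop)]
  have hcont : Continuous fun t : ℝ => 2 * α * Real.exp (β * (t - ρ)) := by fun_prop
  calc _ ≤ ∫⁻ t, (Set.Ico 0 ρ).indicator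
        (fun t => ENNReal.ofReal (2 * α * Real.exp (β * (t - ρ)))) t := by
        refine lintegral_mono fun t => ?_
        simp only [Pi.mul_apply]
        by_cases h : t ∈ Set.Ico 0 ρ
        · rw [Set.indicator_of_mem h, radialDensity, Set.indicator_of_mem h,
            ← ENNReal.ofReal_mul (div_nonneg (mul_nonneg hα0.le
              (Real.sinh_nonneg_iff.2 (mul_nonneg hα0.le h.1))) hZ0.le)]
          refine ENNReal.ofReal_le_ofReal ?_
          have h1 : Real.sinh (α * t) ≤ Real.exp (α * t) / 2 := by
            rw [Real.sinh_eq]; linarith [Real.exp_pos (-(α * t))]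
          have h2 : Real.exp (α * ρ) / 4 ≤ Real.cosh (α * ρ) - 1 := by
            rw [Real.cosh_eq]; linarith [Real.exp_pos (-(α * ρ))]
          calc α * Real.sinh (α * t) / (Real.cosh (α * ρ) - 1) * Real.exp ((ρ - t) / 2)
              ≤ α * (Real.exp (α * t) / 2) / (Real.exp (α * ρ) / 4) *
                  Real.exp ((ρ - t) / 2) := by gcongr
            _ = 2 * α * (Real.exp (α * t) / Real.exp (α * ρ) * Real.exp ((ρ - t) / 2)) := by
                field_simp; ring
            _ = 2 * α * Real.exp (β * (t - ρ)) := by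
                rw [← Real.exp_sub, ← Real.exp_add, hβ]; ring_nf
        · rw [Set.indicator_of_notMem h, radialDensity, Set.indicator_of_notMem h]; simp
    _ = ∫⁻ t in Set.Ico 0 ρ, ENNReal.ofReal (2 * α * Real.exp (β * (t - ρ))) :=
        lintegral_indicator measurableSet_Ico _
    _ = ENNReal.ofReal (∫ t in Set.Ico 0 ρ, 2 * α * Real.exp (β * (t - ρ))) := by
        rw [ofReal_integral_eq_lintegral_ofReal]
        · exact hcont.integrableOn_Icc.mono_set Set.Ico_subset_Icc_self
        · exact ae_of_all _ fun t => by positivity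
    _ ≤ _ := by
        refine ENNReal.ofReal_le_ofReal ?_
        rw [integral_Ico_eq_integral_Ioc, ← intervalIntegral.integral_of_le hR0.le,
          intervalIntegral.integral_eq_sub_of_hasDerivAt
            (f := fun t => 2 * α / β * Real.exp (β * (t - ρ)))]
        · simp only [sub_self, mul_zero, Real.exp_zero, mul_one]
          have : 0 ≤ 2 * α / β * Real.exp (β * (0 - ρ)) := by positivity
          linarith
        · intro t _
          have := ((((hasDerivAt_id t).sub_const ρ).const_mul β).exp).const_mul (2 * α / β)
          exact this.congr_deriv (by field_simp; rfl)
        · exact hcont.intervalIntegrable _ _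

theorem isProbabilityMeasure_nodeLaw {α ν : ℝ} {n : ℕ} (hα : 0 < α) (hR : 0 < R ν n) :
    IsProbabilityMeasure (nodeLaw α ν n) := by
  have := isProbabilityMeasure_radialLaw hα hR
  exact Measure.isProbabilityMeasure_map measurable_polar.aemeasurable

theorem ae_prod_fst_mem_Ico {α ν : ℝ} {n : ℕ} (hα : 0 < α) (hR : 0 < R ν n) :
    ∀ᵐ p ∂((radialLaw α ν n).prod angularLaw), p.1 ∈ Set.Ico 0 (R ν n) := by
  have := isProbabilityMeasure_radialLaw hα hR
  exact Measure.quasiMeasurePreserving_fst.ae (ae_radialLaw_mem_Ico α ν n)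

theorem nodeLaw_real_radius_mem {α ν : ℝ} {n : ℕ} (hα : 0 < α) (hR : 0 < R ν n) {S : Set ℝ}
    (hS : MeasurableSet S) :
    (nodeLaw α ν n).real {w | radius w ∈ S} = (radialLaw α ν n).real S := by
  have := isProbabilityMeasure_radialLaw hα hR
  have hm : MeasurableSet {w | radius w ∈ S} := measurable_radius hS
  rw [nodeLaw, map_measureReal_apply measurable_polar hm]
  have h1 : ((radialLaw α ν n).prod angularLaw).real (polar ⁻¹' {w | radius w ∈ S}) =
      ((radialLaw α ν n).prod angularLaw).real (S ×ˢ Set.univ) := by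
    refine measureReal_congr ?_
    filter_upwards [ae_prod_fst_mem_Ico hα hR] with p hp
    refine propext ?_
    change radius (polar p) ∈ S ↔ p ∈ S ×ˢ Set.univ
    rw [radius_polar hp.1 p.2]
    simp
  rw [h1, measureReal_prod_prod]
  simp

/-! ### The mass of a ball and its monotonicity. -/

/-- The mass of a ball of radius `R_n` around a point of radius `r`. -/
def ballMass (α ν : ℝ) (n : ℕ) (r : ℝ) : ℝ :=
  ((radialLaw α ν n).prod angularLaw).real
    {p | coshDist r p.1 (Real.cos p.2) ≤ Real.cosh (R ν n)}

theorem measurableSet_coshDist_le (r θ c : ℝ) :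
    MeasurableSet {p : ℝ × ℝ | coshDist r p.1 (Real.cos (θ - p.2)) ≤ c} := by
  refine (isClosed_le ?_ continuous_const).measurableSet
  unfold coshDist
  fun_prop

theorem nodeLaw_real_ball {α ν : ℝ} {n : ℕ} (hα : 0 < α) (hR : 0 < R ν n) (z : 𝔻) :
    (nodeLaw α ν n).real {w | hypDist z w ≤ R ν n} = ballMass α ν n (radius z) := by
  have := isProbabilityMeasure_radialLaw hα hR
  set r := radius z with hr
  set θ := Complex.arg z with hθ
  have hd := measurable_hypDist.comp (measurable_prodMk_left (x := z))
  have hm : MeasurableSet {w | hypDist z w ≤ R ν n} := measurableSet_le hd measurable_const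
  have h1 : polar ⁻¹' {w | hypDist z w ≤ R ν n} =
      {p | coshDist r p.1 (Real.cos (θ - p.2)) ≤ Real.cosh (R ν n)} := by
    ext p
    change hypDist z (polar p) ≤ R ν n ↔ _
    rw [Set.mem_ofPred_eq, ← hypDist_polar_le_iff r θ p.1 p.2 hR.le, hr, hθ, polar_radius_arg]
  have hm0 : MeasurableSet {p : ℝ × ℝ | coshDist r p.1 (Real.cos p.2) ≤ Real.cosh (R ν n)} := by
    simpa using measurableSet_coshDist_le r 0 (Real.cosh (R ν n))
  rw [nodeLaw, map_measureReal_apply measurable_polar hm, h1, ballMass, measureReal_def,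
    measureReal_def, Measure.prod_apply (measurableSet_coshDist_le r θ _),
    Measure.prod_apply hm0]
  congr 1
  refine lintegral_congr fun t => ?_
  have hU : MeasurableSet {κ : ℝ | coshDist r t κ ≤ Real.cosh (R ν n)} := by
    refine (isClosed_le ?_ continuous_const).measurableSet
    unfold coshDist
    fun_prop
  have h2 := angularLaw_real_rotation _ hU θ
  rw [measureReal_def, measureReal_def,
    ENNReal.toReal_eq_toReal_iff' (measure_ne_top _ _) (measure_ne_top _ _)] at h2
  exact h2

theorem ballMass_nonneg (α ν : ℝ) (n : ℕ) (r : ℝ) : 0 ≤ ballMass α ν n r := measureReal_nonneg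

theorem ballMass_le_one {α ν : ℝ} {n : ℕ} (hα : 0 < α) (hR : 0 < R ν n) (r : ℝ) :
    ballMass α ν n r ≤ 1 := by
  have := isProbabilityMeasure_radialLaw hα hR
  exact measureReal_le_one

/-- Almost every p has radius below R_n, so the ball around p contains the centre of the disc and,
by convexity, meets each ray in an initial segment: moving a neighbour of p inwards keeps it a
neighbour. -/
theorem ae_coshDist_le_of_le {α ν : ℝ} {n : ℕ} (hα : 0 < α) (hR : 0 < R ν n) {r s : ℝ}
    (hr : 0 ≤ r) (hrs : r ≤ s) : ∀ᵐ p ∂((radialLaw α ν n).prod angularLaw),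
      coshDist s p.1 (Real.cos p.2) ≤ Real.cosh (R ν n) →
      coshDist r p.1 (Real.cos p.2) ≤ Real.cosh (R ν n) := by
  filter_upwards [ae_prod_fst_mem_Ico hα hR] with p hp h
  rw [coshDist_comm] at h ⊢
  refine coshDist_le_of_le hr hrs (Real.cosh_le_cosh.2 ?_) h
  rw [abs_of_nonneg hp.1, abs_of_nonneg hR.le]
  exact hp.2.le

theorem ballMass_anti {α ν : ℝ} {n : ℕ} (hα : 0 < α) (hR : 0 < R ν n) {r s : ℝ}
    (hr : 0 ≤ r) (hrs : r ≤ s) : ballMass α ν n s ≤ ballMass α ν n r := by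
  have := isProbabilityMeasure_radialLaw hα hR
  refine ENNReal.toReal_mono (measure_ne_top _ _) (measure_mono_ae ?_)
  filter_upwards [ae_coshDist_le_of_le hα hR hr hrs] with p hp h using hp h

/-! ### Lower bound for the decrease of the mass. -/

/-- `coshDist` lies above its tangents in the second variable. -/
theorem coshDist_tangent_le {κ : ℝ} (hκ : |κ| ≤ 1) (r s h : ℝ) :
    coshDist r s κ + h * (Real.cosh r * Real.sinh s - κ * (Real.sinh r * Real.cosh s)) ≤
      coshDist r (s + h) κ := by
  obtain ⟨hκ1, hκ2⟩ := abs_le.1 hκ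
  have hpos : 0 ≤ Real.cosh r - κ * Real.sinh r := by
    have h1 : Real.cosh r - κ * Real.sinh r =
        ((1 - κ) * Real.exp r + (1 + κ) * Real.exp (-r)) / 2 := by
      rw [Real.cosh_eq, Real.sinh_eq]; ring
    rw [h1]
    have := Real.exp_pos r
    have := Real.exp_pos (-r)
    have : 0 ≤ 1 - κ := by linarith
    have : 0 ≤ 1 + κ := by linarith
    positivity
  have hneg : 0 ≤ Real.cosh r + κ * Real.sinh r := by
    have h1 : Real.cosh r + κ * Real.sinh r =
        ((1 + κ) * Real.exp r + (1 - κ) * Real.exp (-r)) / 2 := by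
      rw [Real.cosh_eq, Real.sinh_eq]; ring
    rw [h1]
    have := Real.exp_pos r
    have := Real.exp_pos (-r)
    have : 0 ≤ 1 - κ := by linarith
    have : 0 ≤ 1 + κ := by linarith
    positivity
  -- A combination of e^h and e^(-h) with nonnegative coefficients is convex, and e^(±h) ≥ 1 ± h.
  have e1 : coshDist r (s + h) κ =
      (Real.exp s * (Real.cosh r - κ * Real.sinh r) * Real.exp h +
        Real.exp (-s) * (Real.cosh r + κ * Real.sinh r) * Real.exp (-h)) / 2 := by
    rw [coshDist, Real.cosh_eq (s + h), Real.sinh_eq (s + h), neg_add, Real.exp_add, Real.exp_add]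
    ring
  have e2 : coshDist r s κ + h * (Real.cosh r * Real.sinh s - κ * (Real.sinh r * Real.cosh s)) =
      (Real.exp s * (Real.cosh r - κ * Real.sinh r) * (h + 1) +
        Real.exp (-s) * (Real.cosh r + κ * Real.sinh r) * (-h + 1)) / 2 := by
    rw [coshDist, Real.cosh_eq s, Real.sinh_eq s]
    ring
  rw [e1, e2]
  have := mul_le_mul_of_nonneg_left (Real.add_one_le_exp h)
    (mul_nonneg (Real.exp_pos s).le hpos)
  have := mul_le_mul_of_nonneg_left (Real.add_one_le_exp (-h))
    (mul_nonneg (Real.exp_pos (-s)).le hneg)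
  linarith

set_option maxHeartbeats 1000000 in
/-- For suitable angles, an interval of radii of length proportional to `η` belongs to the ball
around a point of radius `r` but not to the ball around a point of radius `r + η`. -/
theorem exists_interval_coshDist {ρ r η κ : ℝ} (hr : 0 ≤ r) (hrρ : r + 3 ≤ ρ) (hρ : 5 ≤ ρ)
    (hη : 0 ≤ η) (hη1 : η ≤ 1) (hκ : |κ| ≤ 1) (hκl : 25 / 8 ≤ (1 - κ) * (1 + Real.exp r))
    (hκu : (1 - κ) * (1 + Real.exp r) ≤ 98 / 25) :
    ∃ τ, ρ - 2 ≤ τ ∧ τ ≤ ρ ∧ ∀ t ∈ Set.Ioo (τ - η / 28) τ,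
      coshDist r t κ ≤ Real.cosh ρ ∧ Real.cosh ρ < coshDist (r + η) t κ := by
  obtain ⟨hκ1, hκ2⟩ := abs_le.1 hκ
  set y := 1 - κ with hy
  have hκy : κ = 1 - y := by rw [hy]; ring
  have hy0 : 0 ≤ y := by linarith
  set z := Real.exp r with hz
  have hz1 : 1 ≤ z := Real.one_le_exp hr
  have hz0 : 0 < z := by linarith
  set x := Real.exp (-r) with hx
  have hx0 : 0 < x := Real.exp_pos _
  have hzx : z * x = 1 := by rw [hz, hx, ← Real.exp_add]; simp
  have hx1 : x ≤ 1 := by nlinarith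
  have hch : Real.cosh r = (z + x) / 2 := Real.cosh_eq r
  have hsh : Real.sinh r = (z - x) / 2 := Real.sinh_eq r
  have hysh : y * (z - x) = y * (1 + z) * (1 - x) := by linear_combination y * hzx
  have hcont : ContinuousOn (fun t => coshDist r t κ) (Set.Icc (ρ - 2) ρ) := by
    unfold coshDist; fun_prop
  -- The leading factor of cosh t lies between 1 + 9/16 (1 - e^(-r)) and 2 for these angles, so the
  -- ray leaves the ball around r at a radius between ρ - 2 and ρ.
  have hleft : coshDist r (ρ - 2) κ ≤ Real.cosh ρ := by
    have h1 : coshDist r (ρ - 2) κ = (x + y * (z - x) / 2) * Real.cosh (ρ - 2) +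
        κ * (Real.sinh r * Real.exp (-(ρ - 2))) := by
      rw [coshDist, hch, hsh, ← Real.cosh_sub_sinh (ρ - 2), hκy]; ring
    have h2 : x + y * (z - x) / 2 ≤ 2 := by rw [hysh]; nlinarith
    have h3 : Real.sinh r * Real.exp (-(ρ - 2)) ≤ 1 := by
      have h4 : Real.sinh r ≤ z := by rw [hsh]; linarith
      calc Real.sinh r * Real.exp (-(ρ - 2)) ≤ z * Real.exp (-(ρ - 2)) := by gcongr
        _ ≤ 1 := by
          rw [hz, ← Real.exp_add]; exact Real.exp_le_one_iff.2 (by linarith)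
    have h5 : κ * (Real.sinh r * Real.exp (-(ρ - 2))) ≤ 1 := by
      have : 0 ≤ Real.sinh r * Real.exp (-(ρ - 2)) :=
        mul_nonneg (Real.sinh_nonneg_iff.2 hr) (Real.exp_pos _).le
      nlinarith
    have h6 := Real.one_le_cosh (ρ - 2)
    have h7 : 3 * Real.cosh (ρ - 2) ≤ Real.cosh ρ := by
      have h8 : Real.cosh (ρ - 2) ≤ Real.exp (ρ - 2) := by
        rw [Real.cosh_eq]
        have : Real.exp (-(ρ - 2)) ≤ Real.exp (ρ - 2) := Real.exp_le_exp.2 (by linarith)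
        linarith
      have h9 : Real.exp ρ = Real.exp (ρ - 2) * (Real.exp 1) ^ 2 := by
        rw [← Real.exp_nat_mul, ← Real.exp_add]; congr 1; push_cast; ring
      have h10 : 6 ≤ Real.exp 1 ^ 2 := by
        have := Real.exp_one_gt_d9; nlinarith
      have h11 : Real.exp ρ / 2 ≤ Real.cosh ρ := by
        rw [Real.cosh_eq]; linarith [Real.exp_pos (-ρ)]
      have := Real.exp_pos (ρ - 2)
      nlinarith
    rw [h1]
    nlinarith
  have hcρ : 4 ≤ Real.cosh (ρ - 2) := by
    rw [Real.cosh_eq]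
    have h1 : Real.exp 3 ≤ Real.exp (ρ - 2) := Real.exp_le_exp.2 (by linarith)
    have h2 : (8 : ℝ) ≤ Real.exp 3 := by
      have h3 : Real.exp 3 = (Real.exp 1) ^ 3 := by rw [← Real.exp_nat_mul]; norm_num
      have h4 : (2 : ℝ) ≤ Real.exp 1 := by have := Real.exp_one_gt_d9; linarith
      rw [h3]
      calc (8 : ℝ) = 2 ^ 3 := by norm_num
        _ ≤ _ := pow_le_pow_left₀ (by norm_num) h4 3
    linarith [Real.exp_pos (-(ρ - 2))]
  have hcoshmono : ∀ {t : ℝ}, ρ - 2 ≤ t → 4 ≤ Real.cosh t := fun {t} ht =>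
    hcρ.trans (Real.cosh_le_cosh.2 (by
      rw [abs_of_nonneg (by linarith), abs_of_nonneg (by linarith)]; exact ht))
  have hright : Real.cosh ρ ≤ coshDist r ρ κ := by
    have h1 : coshDist r ρ κ = (x + y * (z - x) / 2) * Real.cosh ρ +
        κ * (Real.sinh r * Real.exp (-ρ)) := by
      rw [coshDist, hch, hsh, ← Real.cosh_sub_sinh ρ, hκy]; ring
    have h2 : 1 + 9 / 16 * (1 - x) ≤ x + y * (z - x) / 2 := by rw [hysh]; nlinarith
    have h3 : Real.sinh r * Real.exp (-ρ) ≤ 1 - x := by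
      have h4 : Real.sinh r = (1 - x) * ((z + 1) / 2) := by
        rw [hsh]; linear_combination hzx / 2
      have h5 : (z + 1) / 2 * Real.exp (-ρ) ≤ 1 := by
        calc (z + 1) / 2 * Real.exp (-ρ) ≤ z * Real.exp (-ρ) := by gcongr; linarith
          _ ≤ 1 := by rw [hz, ← Real.exp_add]; exact Real.exp_le_one_iff.2 (by linarith)
      rw [h4, mul_assoc]
      nlinarith
    have h5 : -(1 - x) ≤ κ * (Real.sinh r * Real.exp (-ρ)) := by
      have : 0 ≤ Real.sinh r * Real.exp (-ρ) :=
        mul_nonneg (Real.sinh_nonneg_iff.2 hr) (Real.exp_pos _).le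
      nlinarith
    have h6 : 4 ≤ Real.cosh ρ := hcoshmono (by linarith)
    rw [h1]
    have h7 := mul_le_mul_of_nonneg_right h2 (Real.cosh_pos ρ).le
    have h8 := mul_le_mul_of_nonneg_left h6 (sub_nonneg.2 hx1)
    linarith
  obtain ⟨τ, ⟨hτl, hτu⟩, hτ⟩ := intermediate_value_Icc (by linarith) hcont ⟨hleft, hright⟩
  simp only at hτ
  refine ⟨τ, hτl, hτu, fun t ht => ⟨?_, ?_⟩⟩
  · refine coshDist_le_of_le (s := τ) (by linarith [ht.1]) ht.2.le (Real.cosh_le_cosh.2 ?_) hτ.le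
    rw [abs_of_nonneg hr, abs_of_nonneg (by linarith)]; linarith
  have hcτ : 4 ≤ Real.cosh τ := hcoshmono hτl
  -- Tangent in the radius of the centre: the slope at r is at least cosh τ / 2 - 1, and cosh τ ≥ 4.
  have hx_growth : Real.cosh ρ + η * (Real.cosh τ / 4) ≤ coshDist (r + η) τ κ := by
    have h1 := coshDist_tangent_le hκ τ r η
    rw [coshDist_comm τ, coshDist_comm τ, hτ] at h1
    refine le_trans (add_le_add_right (mul_le_mul_of_nonneg_left ?_ hη) _) h1
    have h2 : Real.cosh τ * Real.sinh r - κ * (Real.sinh τ * Real.cosh r) =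
        (y * (z + x) / 2 - x) * Real.cosh τ + κ * (Real.cosh r * Real.exp (-τ)) := by
      rw [hch, hsh, ← Real.cosh_sub_sinh τ, hκy]; ring
    have h3 : Real.cosh r * Real.exp (-τ) ≤ 1 := by
      calc Real.cosh r * Real.exp (-τ) ≤ z * Real.exp (-τ) := by gcongr; rw [hch]; linarith
        _ ≤ 1 := by rw [hz, ← Real.exp_add]; exact Real.exp_le_one_iff.2 (by linarith)
    have h4 : -1 ≤ κ * (Real.cosh r * Real.exp (-τ)) := by
      have : 0 ≤ Real.cosh r * Real.exp (-τ) := by positivity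
      nlinarith
    have h5 : 1 / 2 ≤ y * (z + x) / 2 - x := by
      have h6 : (1 + z) * (x + 1 / 2) ≤ (1 + z) * (y * (z + x) / 2) := by
        have h7 : 25 / 8 * (z + x) ≤ y * (1 + z) * (z + x) := by gcongr
        have h8 : 0 ≤ (17 / 16 * z ^ 2 - 3 / 2 * z + 9 / 16) * x := by
          refine mul_nonneg ?_ hx0.le
          nlinarith [sq_nonneg (z - 12 / 17)]
        nlinarith
      have := le_of_mul_le_mul_left h6 (by linarith)
      linarith
    rw [h2]
    nlinarith
  -- Tangent in the radius of the other point: the slope factor is at most 1 + (98/25)(3/2) < 7,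
  -- with e^η ≤ 3.
  have ht_growth : coshDist (r + η) τ κ - (τ - t) * (7 * Real.cosh τ) ≤ coshDist (r + η) t κ := by
    have h1 := coshDist_tangent_le hκ (r + η) τ (t - τ)
    rw [add_sub_cancel] at h1
    refine le_trans ?_ h1
    have h2 : Real.cosh (r + η) * Real.sinh τ - κ * (Real.sinh (r + η) * Real.cosh τ) ≤
        7 * Real.cosh τ := by
      have h3 : Real.cosh (r + η) * Real.sinh τ ≤ Real.cosh (r + η) * Real.cosh τ :=
        mul_le_mul_of_nonneg_left (Real.sinh_lt_cosh τ).le (Real.cosh_pos _).le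
      have h4 : Real.cosh (r + η) - κ * Real.sinh (r + η) ≤ 7 := by
        have h5 : Real.cosh (r + η) - κ * Real.sinh (r + η) =
            Real.exp (-(r + η)) + y * Real.sinh (r + η) := by
          rw [← Real.cosh_sub_sinh, hκy]; ring
        have h6 : Real.exp (-(r + η)) ≤ 1 := Real.exp_le_one_iff.2 (by linarith)
        have h7 : Real.sinh (r + η) ≤ (1 + z) * 3 / 2 := by
          have h8 : Real.exp (r + η) ≤ z * 3 := by
            rw [Real.exp_add]
            have : Real.exp η ≤ 3 := by
              have h9 : Real.exp η ≤ Real.exp 1 := Real.exp_le_exp.2 hη1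
              have := Real.exp_one_lt_d9; linarith
            gcongr
          rw [Real.sinh_eq]
          linarith [Real.exp_pos (-(r + η))]
        have h10 : y * Real.sinh (r + η) ≤ y * ((1 + z) * 3 / 2) := by gcongr
        rw [h5]
        nlinarith
      nlinarith [Real.cosh_pos τ]
    nlinarith [ht.2]
  -- The length η/28 comes from 28 = 4 · 7, the ratio of the two slopes.
  have h1 : (τ - t) * (7 * Real.cosh τ) < η * (Real.cosh τ / 4) := by
    have : τ - t < η / 28 := by linarith [ht.1]
    nlinarith
  linarith

/-- These are angles with sin(φ/2) between a and b; arcsin expands distances because sin is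
1-Lipschitz. -/
theorem le_angularLaw_Icc {a b : ℝ} (ha : 0 ≤ a) (hab : a ≤ b) (hb : b ≤ 1) :
    ENNReal.ofReal ((b - a) / Real.pi) ≤
      angularLaw (Set.Icc (2 * Real.arcsin a) (2 * Real.arcsin b)) := by
  have hpi := Real.pi_pos
  have h0 : 0 ≤ Real.arcsin a := Real.arcsin_nonneg.2 ha
  have h1 : Real.arcsin b ≤ Real.pi / 2 := Real.arcsin_le_pi_div_two b
  have h2 : Real.arcsin a ≤ Real.arcsin b := Real.monotone_arcsin hab
  have h3 : b - a ≤ Real.arcsin b - Real.arcsin a := by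
    have h := Real.abs_sin_sub_sin_le (Real.arcsin b) (Real.arcsin a)
    rw [Real.sin_arcsin (by linarith) hb, Real.sin_arcsin (by linarith) (by linarith),
      abs_of_nonneg (by linarith), abs_of_nonneg (by linarith)] at h
    exact h
  have h4 : Set.Ioc (-Real.pi) Real.pi ∩ Set.Icc (2 * Real.arcsin a) (2 * Real.arcsin b) =
      Set.Icc (2 * Real.arcsin a) (2 * Real.arcsin b) := by
    refine Set.inter_eq_right.2 fun t ht => ⟨?_, ?_⟩
    · linarith [ht.1]
    · linarith [ht.2]
  rw [angularLaw, cond_apply measurableSet_Ioc, h4, Real.volume_Ioc, Real.volume_Icc,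
    ← ENNReal.ofReal_inv_of_pos (by linarith), ← ENNReal.ofReal_mul (inv_nonneg.2 (by linarith))]
  refine ENNReal.ofReal_le_ofReal ?_
  rw [inv_mul_eq_div, div_le_div_iff₀ hpi (by linarith)]
  nlinarith

/-- The constant of the lower bound for the decrease of the mass of a ball. -/
def gapConst (α : ℝ) : ℝ := α * Real.exp (-(3 * α)) / 4 / 28 / 40

theorem gapConst_pos {α : ℝ} (hα : 0 < α) : 0 < gapConst α := by
  unfold gapConst; positivity

/-- The lost crescent contains, for each angle in a window of mass of order e^(-r/2), a radial
interval of length η/28 near the rim. Integrating over the angle multiplies the two masses. -/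
theorem ballMass_gap {α ν : ℝ} {n : ℕ} (hα : 0 < α) (hR : 5 + 1 / α ≤ R ν n) {r η : ℝ}
    (hr : 0 ≤ r) (hrR : r + 3 ≤ R ν n) (hη : 0 ≤ η) (hη1 : η ≤ 1) :
    gapConst α * η * Real.exp (-(r / 2)) ≤ ballMass α ν n r - ballMass α ν n (r + η) := by
  have hα' : 0 < 1 / α := by positivity
  have hR0 : 0 < R ν n := by linarith
  have := isProbabilityMeasure_radialLaw hα hR0
  have hpi := Real.pi_pos
  set P := (radialLaw α ν n).prod angularLaw with hP
  set c := Real.cosh (R ν n) with hc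
  have hm : ∀ s, MeasurableSet {p : ℝ × ℝ | coshDist s p.1 (Real.cos p.2) ≤ c} := fun s => by
    simpa using measurableSet_coshDist_le s 0 c
  set S : Set (ℝ × ℝ) := {p | coshDist r p.1 (Real.cos p.2) ≤ c ∧
    c < coshDist (r + η) p.1 (Real.cos p.2)} with hS
  have hSm : MeasurableSet S := by
    have : S = {p : ℝ × ℝ | coshDist r p.1 (Real.cos p.2) ≤ c} \
        {p : ℝ × ℝ | coshDist (r + η) p.1 (Real.cos p.2) ≤ c} := by
      ext p; simp [hS]
    rw [this]
    exact (hm r).diff (hm (r + η))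
  have h1 : P.real S + ballMass α ν n (r + η) ≤ ballMass α ν n r := by
    rw [ballMass, ← hP, ← measureReal_union _ (hm (r + η))]
    · refine ENNReal.toReal_mono (measure_ne_top _ _) (measure_mono_ae ?_)
      filter_upwards [ae_coshDist_le_of_le hα hR0 hr (by linarith : r ≤ r + η)] with p hp h
      rcases h with h | h
      · exact h.1
      · exact hp h
    · rw [Set.disjoint_left]
      intro p hp hp'
      exact absurd hp.2 (not_lt.2 hp')
  suffices h2 : gapConst α * η * Real.exp (-(r / 2)) ≤ P.real S by linarith
  set z := Real.exp r with hz
  have hz1 : 1 ≤ z := Real.one_le_exp hr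
  -- Then (1 - cos φ)(1 + e^r) = 2 (sin(φ/2)/v)², so sin(φ/2) between 5v/4 and 7v/5 gives exactly
  -- the bounds 25/8 and 98/25. As v ≤ 1/√2 and 7/5 < √2, such angles exist even at r = 0.
  set v := 1 / √(1 + z) with hv
  have hsq : √(1 + z) ^ 2 = 1 + z := Real.sq_sqrt (by linarith)
  have hs0 : 0 < √(1 + z) := Real.sqrt_pos.2 (by linarith)
  have hv0 : 0 < v := by positivity
  have hv2 : v ^ 2 * (1 + z) = 1 := by
    rw [hv, div_pow, hsq, one_pow]; field_simp
  have hv1 : 7 / 5 * v ≤ 1 := by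
    have : v ^ 2 ≤ 1 / 2 := by nlinarith [sq_nonneg v]
    nlinarith
  have hvl : Real.exp (-(r / 2)) ≤ 3 / 2 * v := by
    have e1 : Real.exp (-(r / 2)) ^ 2 * z = 1 := by
      rw [← Real.exp_nat_mul, hz, ← Real.exp_add, ← Real.exp_zero]; congr 1; push_cast; ring
    have e2 : Real.exp (-(r / 2)) ^ 2 ≤ (3 / 2 * v) ^ 2 := by
      have : 0 < z * (1 + z) := by positivity
      refine le_of_mul_le_mul_right ?_ this
      calc _ = (Real.exp (-(r / 2)) ^ 2 * z) * (1 + z) := by ring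
        _ = 1 + z := by rw [e1, one_mul]
        _ ≤ 9 / 4 * z * (v ^ 2 * (1 + z)) := by rw [hv2]; linarith
        _ = _ := by ring
    exact (sq_le_sq₀ (Real.exp_pos _).le (by positivity)).1 e2
  set I := Set.Icc (2 * Real.arcsin (5 / 4 * v)) (2 * Real.arcsin (7 / 5 * v)) with hI
  have hang := le_angularLaw_Icc (a := 5 / 4 * v) (b := 7 / 5 * v) (by positivity)
    (by linarith) hv1
  have hcond : ∀ φ ∈ I, ENNReal.ofReal (α * Real.exp (-(3 * α)) / 4 * (η / 28)) ≤
      radialLaw α ν n ((fun t => (t, φ)) ⁻¹' S) := by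
    intro φ hφ
    have hb0 : 0 ≤ Real.arcsin (5 / 4 * v) := Real.arcsin_nonneg.2 (by positivity)
    have hb1 : Real.arcsin (7 / 5 * v) ≤ Real.pi / 2 := Real.arcsin_le_pi_div_two _
    have hs1 : 5 / 4 * v ≤ Real.sin (φ / 2) := by
      have : Real.arcsin (5 / 4 * v) ≤ φ / 2 := by linarith [hφ.1]
      exact (Real.arcsin_le_iff_le_sin ⟨by linarith, by linarith⟩
        ⟨by linarith, by linarith [hφ.2]⟩).1 this
    have hs2 : Real.sin (φ / 2) ≤ 7 / 5 * v := by
      have : φ / 2 ≤ Real.arcsin (7 / 5 * v) := by linarith [hφ.2]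
      exact (Real.le_arcsin_iff_sin_le' ⟨by linarith [hφ.1], by linarith⟩).1 this
    have hcos : 1 - Real.cos φ = 2 * Real.sin (φ / 2) ^ 2 := by
      have := Real.cos_two_mul (φ / 2)
      have h3 := Real.sin_sq_add_cos_sq (φ / 2)
      rw [show 2 * (φ / 2) = φ by ring] at this
      linarith
    have hl2 : (5 / 4 * v) ^ 2 ≤ Real.sin (φ / 2) ^ 2 :=
      pow_le_pow_left₀ (by positivity) hs1 2
    have hu2 : Real.sin (φ / 2) ^ 2 ≤ (7 / 5 * v) ^ 2 :=
      pow_le_pow_left₀ (by linarith [mul_pos (by norm_num : (0 : ℝ) < 5 / 4) hv0]) hs2 2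
    obtain ⟨τ, hτ1, hτ2, hτ⟩ := exists_interval_coshDist hr hrR (by linarith) hη hη1
      (Real.abs_cos_le_one φ) (by rw [hcos, ← hz]; nlinarith) (by rw [hcos, ← hz]; nlinarith)
    have h3 := le_radialLaw_Ioo (ν := ν) (n := n) (a := τ - η / 28) (b := τ) hα (by linarith)
      (by linarith) hτ2
    rw [sub_sub_cancel] at h3
    exact h3.trans (measure_mono fun t ht => hτ t ht)
  have hlow : ENNReal.ofReal (α * Real.exp (-(3 * α)) / 4 * (η / 28)) *
      ENNReal.ofReal ((7 / 5 * v - 5 / 4 * v) / Real.pi) ≤ P S := by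
    rw [hP, Measure.prod_apply_symm hSm]
    calc _ ≤ ENNReal.ofReal (α * Real.exp (-(3 * α)) / 4 * (η / 28)) * angularLaw I := by gcongr
      _ = ∫⁻ _φ in I, ENNReal.ofReal (α * Real.exp (-(3 * α)) / 4 * (η / 28)) ∂angularLaw :=
          (setLIntegral_const _ _).symm
      _ ≤ ∫⁻ φ in I, radialLaw α ν n ((fun t => (t, φ)) ⁻¹' S) ∂angularLaw :=
          setLIntegral_mono (measurable_measure_prodMk_right hSm) hcond
      _ ≤ _ := setLIntegral_le_lintegral _ _
  rw [← ENNReal.ofReal_mul (by positivity)] at hlow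
  have h4 := ENNReal.ofReal_le_iff_le_toReal (measure_ne_top P S) |>.1 hlow
  refine le_trans ?_ h4
  -- The 1/40 in `gapConst` is (7/5 - 5/4) · (2/3) / 4, from e^(-r/2) ≤ 3v/2 and π ≤ 4.
  have h5 : 1 / 40 * Real.exp (-(r / 2)) ≤ (7 / 5 * v - 5 / 4 * v) / Real.pi := by
    rw [le_div_iff₀ hpi]
    have h6 : Real.pi ≤ 4 := Real.pi_le_four
    calc 1 / 40 * Real.exp (-(r / 2)) * Real.pi ≤ 1 / 40 * (3 / 2 * v) * 4 := by gcongr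
      _ = 7 / 5 * v - 5 / 4 * v := by ring
  calc gapConst α * η * Real.exp (-(r / 2))
      = α * Real.exp (-(3 * α)) / 4 * (η / 28) * (1 / 40 * Real.exp (-(r / 2))) := by
        unfold gapConst; ring
    _ ≤ _ := by gcongr

/-! ### Upper bound for the mass of a ball. -/

theorem angularLaw_cos_le {r t ρ : ℝ} (hr : 0 ≤ r) (hrρ : r ≤ ρ) (htρ : t ≤ ρ) :
    angularLaw {φ | coshDist r t (Real.cos φ) ≤ Real.cosh ρ} ≤
      ENNReal.ofReal (3 * Real.exp ((ρ - r - t) / 2)) := by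
  have hpi := Real.pi_pos
  set e := 3 * Real.exp ((ρ - r - t) / 2) with he
  have he0 : 0 < e := by positivity
  have hexp : ∀ x : ℝ, -1 ≤ x → 1 ≤ 3 * Real.exp (x / 2) := fun x hx => by
    have := Real.add_one_le_exp (x / 2)
    linarith
  -- For radii at least 1, sinh is comparable to exp, and Jordan's inequality converts the bound on
  -- sin(φ/2) into one on φ. If r or t is below 1, then ρ - r - t ≥ -1 and the bound exceeds 1.
  by_cases hrt : 1 ≤ r ∧ 1 ≤ t
  · obtain ⟨hr1, ht1⟩ := hrt
    have hsub : Set.Ioc (-Real.pi) Real.pi ∩ {φ | coshDist r t (Real.cos φ) ≤ Real.cosh ρ} ⊆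
        Set.Icc (-(Real.pi * e)) (Real.pi * e) := by
      rintro φ ⟨hφ, hd⟩
      have hφ2 : |φ / 2| ≤ Real.pi / 2 := abs_le.2 ⟨by linarith [hφ.1], by linarith [hφ.2]⟩
      have hj := Real.mul_abs_le_abs_sin hφ2
      have hcos : Real.cos φ = 1 - 2 * Real.sin (φ / 2) ^ 2 := by
        have := Real.cos_two_mul (φ / 2)
        have h3 := Real.sin_sq_add_cos_sq (φ / 2)
        rw [show 2 * (φ / 2) = φ by ring] at this
        linarith
      have hs : ∀ x : ℝ, 1 ≤ x → Real.exp x / 4 ≤ Real.sinh x := fun x hx => by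
        rw [Real.sinh_eq]
        have := Real.add_one_le_exp x
        have : Real.exp (-x) ≤ 1 := Real.exp_le_one_iff.2 (by linarith)
        linarith
      have hcd : coshDist r t (Real.cos φ) =
          Real.cosh (r - t) + 2 * Real.sin (φ / 2) ^ 2 * (Real.sinh r * Real.sinh t) := by
        rw [coshDist, Real.cosh_sub, hcos]; ring
      have hd' : coshDist r t (Real.cos φ) ≤ Real.cosh ρ := hd
      rw [hcd] at hd'
      have hcρ : Real.cosh ρ ≤ Real.exp ρ := by
        rw [Real.cosh_eq]
        have : Real.exp (-ρ) ≤ Real.exp ρ := Real.exp_le_exp.2 (by linarith)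
        linarith
      have h1 : Real.exp r / 4 * (Real.exp t / 4) ≤ Real.sinh r * Real.sinh t :=
        mul_le_mul (hs r hr1) (hs t ht1) (by positivity) (Real.sinh_nonneg_iff.2 hr)
      have h2 : Real.sin (φ / 2) ^ 2 ≤ e ^ 2 := by
        have h3 : 2 * Real.sin (φ / 2) ^ 2 * (Real.exp r / 4 * (Real.exp t / 4)) ≤ Real.exp ρ := by
          have h4 : 2 * Real.sin (φ / 2) ^ 2 * (Real.exp r / 4 * (Real.exp t / 4)) ≤
              2 * Real.sin (φ / 2) ^ 2 * (Real.sinh r * Real.sinh t) := by gcongr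
          linarith [Real.cosh_pos (r - t)]
        have h5 : e ^ 2 * (Real.exp r * Real.exp t) = 9 * Real.exp ρ := by
          rw [he, mul_pow, ← Real.exp_nat_mul, mul_assoc, ← Real.exp_add, ← Real.exp_add]
          norm_num
          ring
        have h6 : 0 < Real.exp r * Real.exp t := by positivity
        refine le_of_mul_le_mul_right ?_ h6
        rw [h5]
        linarith [Real.exp_pos ρ]
      have h3 : |Real.sin (φ / 2)| ≤ e := abs_le_of_sq_le_sq h2 he0.le
      have h4 : |φ| ≤ Real.pi * e := by
        rw [abs_div, abs_two] at hj
        have h5 : |φ| / Real.pi ≤ e := by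
          calc |φ| / Real.pi = 2 / Real.pi * (|φ| / 2) := by ring
            _ ≤ e := hj.trans h3
        rw [div_le_iff₀ hpi] at h5
        linarith
      exact abs_le.1 h4
    rw [angularLaw, cond_apply measurableSet_Ioc]
    calc _ ≤ (volume (Set.Ioc (-Real.pi) Real.pi))⁻¹ *
          volume (Set.Icc (-(Real.pi * e)) (Real.pi * e)) := by gcongr
      _ = _ := by
        rw [Real.volume_Ioc, Real.volume_Icc, ← ENNReal.ofReal_inv_of_pos (by linarith),
          ← ENNReal.ofReal_mul (inv_nonneg.2 (by linarith))]
        congr 1; field_simp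
  · refine prob_le_one.trans ?_
    rw [← ENNReal.ofReal_one]
    refine ENNReal.ofReal_le_ofReal (hexp _ ?_)
    by_contra hlt
    exact hrt ⟨by linarith, by linarith⟩

theorem ballMass_le {α ν : ℝ} {n : ℕ} (hα : 1 / 2 < α) (hR : 4 ≤ Real.exp (α * R ν n))
    (hR0 : 0 < R ν n) {r : ℝ} (hr : 0 ≤ r) (hrR : r ≤ R ν n) :
    ballMass α ν n r ≤ 6 * α / (α - 1 / 2) * Real.exp (-(r / 2)) := by
  have hα0 : 0 < α := by linarith
  have hα2 : 0 < α - 1 / 2 := by linarith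
  have := isProbabilityMeasure_radialLaw hα0 hR0
  have hm : MeasurableSet {p : ℝ × ℝ | coshDist r p.1 (Real.cos p.2) ≤ Real.cosh (R ν n)} := by
    simpa using measurableSet_coshDist_le r 0 (Real.cosh (R ν n))
  refine ENNReal.toReal_le_of_le_ofReal (by positivity) ?_
  rw [Measure.prod_apply hm]
  calc _ ≤ ∫⁻ t, ENNReal.ofReal (3 * Real.exp (-(r / 2))) *
        ENNReal.ofReal (Real.exp ((R ν n - t) / 2)) ∂(radialLaw α ν n) := by
        refine lintegral_mono_ae ?_
        filter_upwards [ae_radialLaw_mem_Ico α ν n] with t ht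
        refine (angularLaw_cos_le hr hrR ht.2.le).trans (le_of_eq ?_)
        rw [← ENNReal.ofReal_mul (by positivity), mul_assoc, ← Real.exp_add]
        congr 3; ring
    _ = ENNReal.ofReal (3 * Real.exp (-(r / 2))) *
        ∫⁻ t, ENNReal.ofReal (Real.exp ((R ν n - t) / 2)) ∂(radialLaw α ν n) :=
        lintegral_const_mul _ (by fun_prop)
    _ ≤ ENNReal.ofReal (3 * Real.exp (-(r / 2))) * ENNReal.ofReal (2 * α / (α - 1 / 2)) := by
        gcongr
        exact lintegral_exp_radialLaw_le hα hR hR0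
    _ = _ := by
        rw [← ENNReal.ofReal_mul (by positivity)]
        congr 1; ring

/-! ### The failure probability for fixed n. -/

theorem nodeDegree_eq_neighborCount (ν : ℝ) {n : ℕ} (X : Fin n → 𝔻) (i : Fin n) :
    nodeDegree ν X i = neighborCount (fun z => {w | hypDist z w ≤ R ν n}) X i := by
  classical
  rw [nodeDegree, neighborCount, ← SimpleGraph.card_neighborFinset_eq_degree]
  congr 1
  ext l
  rw [SimpleGraph.mem_neighborFinset]
  simp only [Finset.mem_filter, Finset.mem_univ, true_and, Set.mem_ofPred_eq, graph]
  rw [ne_comm]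

theorem nodesLaw_real_compl_orderingEvent_le {α ν : ℝ} {n : ℕ} (hα : 0 < α)
    (hR : 5 + 1 / α ≤ R ν n) {M η ε : ℝ} (hM : 0 ≤ M) (hMR : M + 3 ≤ R ν n) (hη : 0 < η)
    (hη1 : η ≤ 1) (hε : 0 < ε)
    (hmass : ∀ r, 0 ≤ r → r ≤ M →
      2 * ε * √(ballMass α ν n r) ≤ gapConst α * η * Real.exp (-(r / 2))) (k : ℕ) :
    (nodesLaw α ν n).real (orderingEvent ν k n)ᶜ ≤
      2 ^ k * Real.exp (-(n * ((Real.cosh (α * M) - 1) / (Real.cosh (α * R ν n) - 1)) / 2)) +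
      (n : ℝ) ^ 2 * ((Real.cosh (α * M) - 1) / (Real.cosh (α * R ν n) - 1) *
        (α * Real.sinh (α * (M + η)) / (Real.cosh (α * R ν n) - 1) * η)) +
      (n : ℝ) ^ 2 * Real.exp (-(((n : ℝ) - 2) * ε ^ 2 / 4)) := by
  have hα' : 0 < 1 / α := by positivity
  have hR0 : 0 < R ν n := by linarith
  have := isProbabilityMeasure_nodeLaw hα hR0
  have hprob : (nodeLaw α ν n).real {x | radius x ≤ M} =
      (Real.cosh (α * M) - 1) / (Real.cosh (α * R ν n) - 1) := by
    rw [← radialLaw_real_Iic hα hR0 hM (by linarith)]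
    exact nodeLaw_real_radius_mem hα hR0 measurableSet_Iic
  have hB : MeasurableSet {p : 𝔻 × 𝔻 | p.2 ∈ {w | hypDist p.1 w ≤ R ν n}} :=
    measurableSet_le measurable_hypDist measurable_const
  have h := pi_real_not_ordered_le (nodeLaw α ν n) measurable_radius
    (B := fun z => {w | hypDist z w ≤ R ν n}) hB
    (fun x y h => by rw [Set.mem_ofPred_eq, hypDist_comm] at h; exact h) (M := M) (η := η) hε
    (w := α * Real.sinh (α * (M + η)) / (Real.cosh (α * R ν n) - 1) * η) ?_ ?_ n k
  · rw [hprob] at h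
    refine le_trans (measureReal_mono (μ := Measure.pi fun _ : Fin n => nodeLaw α ν n)
      (fun X hX => ?_) (measure_ne_top _ _)) h
    intro hX'
    refine hX fun σ hσ => ?_
    have h1 : ∀ i j : Fin n, i < j → (i : ℕ) < k →
          nodeDegree ν X (σ j) < nodeDegree ν X (σ i) := by
      intro i j hij hik
      rw [nodeDegree_eq_neighborCount, nodeDegree_eq_neighborCount]
      exact hX' σ hσ i j hij hik
    refine ⟨fun i j hij hjk => h1 i j hij (lt_trans hij hjk), fun i j hik hkj => h1 i j ?_ hik⟩
    exact Fin.lt_def.2 (hik.trans_le hkj)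
  · intro x y hx hxy
    rw [nodeLaw_real_ball hα hR0, nodeLaw_real_ball hα hR0]
    set r := radius x
    have hr : 0 ≤ r := radius_nonneg x
    set p := ballMass α ν n r
    have h1 : ballMass α ν n (radius y) ≤ ballMass α ν n (r + η) :=
      ballMass_anti hα hR0 (by linarith) hxy.le
    have h2 := ballMass_gap hα hR hr (by linarith) hη.le hη1
    have h3 := hmass r hr hx
    have hp : √p ^ 2 = p := Real.sq_sqrt (ballMass_nonneg _ _ _ _)
    have hq : √(ballMass α ν n (radius y)) ^ 2 = ballMass α ν n (radius y) :=
      Real.sq_sqrt (ballMass_nonneg _ _ _ _)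
    have hp0 : 0 ≤ √p := Real.sqrt_nonneg _
    have hq0 : 0 ≤ √(ballMass α ν n (radius y)) := Real.sqrt_nonneg _
    -- The difference of squares is at most 2√p times the difference of the roots, so a mass gap of
    -- 2ε√p forces a gap ε between the roots; √p > 0 is needed to cancel.
    have h4 : 2 * ε * √p ≤ √p ^ 2 - √(ballMass α ν n (radius y)) ^ 2 := by
      rw [hp, hq]; linarith
    have h5 : 0 < √p := by
      have := mul_pos (mul_pos (gapConst_pos hα) hη) (Real.exp_pos (-(r / 2)))
      exact Real.sqrt_pos.2 (by linarith [ballMass_nonneg α ν n (r + η)])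
    by_contra hlt
    rcases le_total ε √p with hle | hle <;> nlinarith
  · intro x hx
    have hr : 0 ≤ radius x := radius_nonneg x
    refine le_trans (le_of_eq (nodeLaw_real_radius_mem hα hR0
      (measurableSet_Icc (a := radius x) (b := radius x + η)))) ?_
    refine (radialLaw_real_Icc_le hα hR0 hr hη.le).trans ?_
    have hZ0 : 0 < Real.cosh (α * R ν n) - 1 := sub_pos.2 (one_lt_cosh_mul_R hα hR0)
    have : Real.sinh (α * (radius x + η)) ≤ Real.sinh (α * (M + η)) :=
      Real.sinh_le_sinh.2 (mul_le_mul_of_nonneg_left (by linarith) hα.le)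
    gcongr

/-! ### Choice of exponents and asymptotics. -/

theorem tendsto_R {ν : ℝ} (hν : 0 < ν) : Tendsto (R ν) atTop atTop := by
  have h : Tendsto (fun n : ℕ => (n : ℝ) / ν) atTop atTop :=
    tendsto_natCast_atTop_atTop.atTop_div_const hν
  exact (Real.tendsto_log_atTop.comp h).const_mul_atTop two_pos

theorem exp_half_mul_R {α ν : ℝ} {n : ℕ} (hν : 0 < ν) (hn : 0 < n) :
    Real.exp (α * R ν n / 2) = (n : ℝ) ^ α * ν ^ (-α) := by
  have hn' : (0 : ℝ) < n := by exact_mod_cast hn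
  rw [R, Real.rpow_def_of_pos hn', Real.rpow_def_of_pos hν, ← Real.exp_add,
    Real.log_div hn'.ne' hν.ne']
  congr 1; ring

theorem cosh_mul_sub_one (α x : ℝ) : Real.cosh (α * x) - 1 = 2 * Real.sinh (α * x / 2) ^ 2 := by
  have h : α * x = 2 * (α * x / 2) := by ring
  rw [h, Real.cosh_two_mul, Real.cosh_sq]; ring_nf

/-- Exponents that make all the error terms small. -/
theorem exists_exponents {α ν : ℝ} (hα : 0 < α) (hν : 0 < ν) : ∃ g b θ D : ℝ, 0 < g ∧ 0 < b ∧
    0 ≤ θ ∧ 0 < D ∧ 1 / 2 - α + 3 * g / 2 < b ∧ 2 * g < b ∧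
    b + g + (2 * max (α - 1 / 2) 0 + g) * θ / α < 1 / 2 ∧
    ∀ᶠ n : ℕ in atTop, ∀ r, 0 ≤ r → r ≤ R ν n →
      √(ballMass α ν n r) ≤ D * Real.exp ((θ - 1 / 2) * r) := by
  -- The two lower bounds on b make close radii unlikely; the upper bound lets the mass gap beat the
  -- fluctuations up to the threshold M, where e^(θM) is at most of order n^((2 max(α-1/2,0)+g)θ/α).
  -- For α ≤ 1/2 the trivial bound on the mass gives θ = 1/2; otherwise √p = O(e^(-r/4)) gives θ =
  -- 1/4.
  rcases le_or_gt α (1 / 2) with h | h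
  · refine ⟨α ^ 2 / 4, 1 / 2 - α / 2, 1 / 2, 1, by positivity, by linarith, by norm_num,
      one_pos, by nlinarith, by nlinarith, ?_, ?_⟩
    · rw [max_eq_right (by linarith)]
      have : (2 * 0 + α ^ 2 / 4) * (1 / 2) / α = α / 8 := by field_simp; ring
      rw [this]; nlinarith
    · filter_upwards [(tendsto_R hν).eventually_gt_atTop 0] with n hn r _ _
      rw [sub_self, zero_mul, Real.exp_zero, one_mul]
      exact Real.sqrt_le_one.2 (ballMass_le_one hα hn r)
  · have hα2 : 0 < α - 1 / 2 := by linarith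
    refine ⟨1 / (32 * α), 1 / (8 * α), 1 / 4, √(6 * α / (α - 1 / 2)), by positivity,
      by positivity, by norm_num, by positivity, ?_, ?_, ?_, ?_⟩
    · have h1 : 1 / (8 * α) = 4 * (1 / (32 * α)) := by field_simp; norm_num
      have : 0 < 1 / (32 * α) := by positivity
      linarith
    · have h1 : 1 / (8 * α) = 4 * (1 / (32 * α)) := by field_simp; norm_num
      have : 0 < 1 / (32 * α) := by positivity
      linarith
    · rw [max_eq_left hα2.le]
      have h1 : 1 / 2 - (1 / (8 * α) + 1 / (32 * α) +
          (2 * (α - 1 / 2) + 1 / (32 * α)) * (1 / 4) / α) = (12 * α - 1) / (128 * α ^ 2) := by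
        field_simp; ring
      have h2 : 0 < (12 * α - 1) / (128 * α ^ 2) := div_pos (by linarith) (by positivity)
      linarith
    · have ht : Tendsto (fun n : ℕ => Real.exp (α * R ν n)) atTop atTop :=
        Real.tendsto_exp_atTop.comp ((tendsto_R hν).const_mul_atTop hα)
      filter_upwards [(tendsto_R hν).eventually_gt_atTop 0, ht.eventually_ge_atTop 4]
        with n hn hn4 r hr hrR
      refine Real.sqrt_le_iff.2 ⟨by positivity, (ballMass_le h hn4 hn hr hrR).trans (le_of_eq ?_)⟩
      rw [mul_pow, Real.sq_sqrt (by positivity), ← Real.exp_nat_mul]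
      congr 2; push_cast; ring

/-- An upper bound for the density at a radius slightly larger than `2 / α * arsinh a`. -/
theorem sinh_two_mul_arsinh_add_le {α a η : ℝ} (hα : 0 < α) (ha : 0 ≤ a) (hη : 0 ≤ η)
    (hη1 : η ≤ 1) : Real.sinh (2 * Real.arsinh a + α * η) ≤
      Real.exp α * (2 + 2 * α) * (a + a ^ 2 + η) := by
  have hx : 0 ≤ α * η := by positivity
  have h1 : Real.sinh (2 * Real.arsinh a) ≤ 2 * a + 2 * a ^ 2 := by
    rw [Real.sinh_two_mul, Real.sinh_arsinh, Real.cosh_arsinh]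
    have : √(1 + a ^ 2) ≤ 1 + a := Real.sqrt_le_iff.2 ⟨by linarith, by nlinarith⟩
    nlinarith
  have h2 : Real.cosh (2 * Real.arsinh a) = 1 + 2 * a ^ 2 := by
    rw [Real.cosh_two_mul, Real.cosh_sq, Real.sinh_arsinh]; ring
  have h3 : Real.exp (α * η) ≤ Real.exp α := Real.exp_le_exp.2 (by nlinarith)
  have h4 : Real.cosh (α * η) ≤ Real.exp α := by
    refine le_trans ?_ h3
    rw [Real.cosh_eq]
    have : Real.exp (-(α * η)) ≤ Real.exp (α * η) := Real.exp_le_exp.2 (by linarith)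
    linarith
  have h5 : Real.sinh (α * η) ≤ Real.exp α * (α * η) := by
    refine le_trans ?_ (mul_le_mul_of_nonneg_right h3 hx)
    rw [Real.sinh_eq]
    have e1 := Real.add_one_le_exp (-(2 * (α * η)))
    have e2 : Real.exp (-(α * η)) = Real.exp (α * η) * Real.exp (-(2 * (α * η))) := by
      rw [← Real.exp_add]; ring_nf
    rw [e2]
    nlinarith [Real.exp_pos (α * η)]
  have hs0 : 0 ≤ Real.sinh (α * η) := Real.sinh_nonneg_iff.2 hx
  rw [Real.sinh_add, h2]
  have hE := Real.exp_pos α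
  calc Real.sinh (2 * Real.arsinh a) * Real.cosh (α * η) + (1 + 2 * a ^ 2) * Real.sinh (α * η)
      ≤ (2 * a + 2 * a ^ 2) * Real.exp α + (1 + 2 * a ^ 2) * (Real.exp α * (α * η)) := by
        gcongr
    _ = Real.exp α * (2 * a + 2 * a ^ 2 + α * η + 2 * α * (a ^ 2 * η)) := by ring
    _ ≤ Real.exp α * (2 * a + 2 * a ^ 2 + α * η + 2 * α * (a ^ 2 * 1)) := by gcongr
    _ ≤ Real.exp α * (2 + 2 * α) * (a + a ^ 2 + η) := by
        rw [mul_assoc (Real.exp α)]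
        refine mul_le_mul_of_nonneg_left ?_ hE.le
        nlinarith [mul_nonneg hα.le ha, mul_nonneg hα.le hη]

theorem tendsto_natCast_rpow_neg {e : ℝ} (he : e < 0) :
    Tendsto (fun n : ℕ => (n : ℝ) ^ e) atTop (𝓝 0) := by
  have := (tendsto_rpow_neg_atTop (neg_pos.2 he)).comp (tendsto_natCast_atTop_atTop (R := ℝ))
  simpa [Function.comp_def] using this

theorem tendsto_natCast_rpow {e : ℝ} (he : 0 < e) :
    Tendsto (fun n : ℕ => (n : ℝ) ^ e) atTop atTop :=
  (tendsto_rpow_atTop he).comp tendsto_natCast_atTop_atTop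

/-- The threshold for the radii of the first nodes: a node has a radius below it with probability
`n ^ (g - 1)`. -/
def threshold (α ν g : ℝ) (n : ℕ) : ℝ :=
  2 / α * Real.arsinh ((n : ℝ) ^ (-(1 - g) / 2) * Real.sinh (α * R ν n / 2))

theorem mul_threshold {α : ℝ} (hα : 0 < α) (ν g : ℝ) (n : ℕ) : α * threshold α ν g n =
    2 * Real.arsinh ((n : ℝ) ^ (-(1 - g) / 2) * Real.sinh (α * R ν n / 2)) := by
  unfold threshold; field_simp

theorem exp_mul_threshold_le {α ν g : ℝ} {n : ℕ} (hα : 0 < α) (hR : 0 ≤ R ν n) :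
    Real.exp (α * threshold α ν g n / 2) ≤
      1 + (n : ℝ) ^ (-(1 - g) / 2) * Real.exp (α * R ν n / 2) := by
  have hS : 0 ≤ Real.sinh (α * R ν n / 2) := Real.sinh_nonneg_iff.2 (by positivity)
  rw [mul_threshold hα, mul_div_cancel_left₀ _ two_ne_zero, Real.exp_arsinh]
  set y := (n : ℝ) ^ (-(1 - g) / 2) with hy
  have hy0 : 0 ≤ y := by positivity
  set a := y * Real.sinh (α * R ν n / 2) with ha
  have ha0 : 0 ≤ a := by positivity
  have h1 : √(1 + a ^ 2) ≤ 1 + a := Real.sqrt_le_iff.2 ⟨by linarith, by nlinarith⟩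
  have h2 : 2 * a ≤ y * Real.exp (α * R ν n / 2) := by
    have : 2 * Real.sinh (α * R ν n / 2) ≤ Real.exp (α * R ν n / 2) := by
      rw [Real.sinh_eq]; linarith [Real.exp_pos (-(α * R ν n / 2))]
    calc 2 * a = y * (2 * Real.sinh (α * R ν n / 2)) := by rw [ha]; ring
      _ ≤ _ := by gcongr
  linarith

theorem eventually_threshold_add_le {α ν g : ℝ} (hα : 0 < α) (hν : 0 < ν) (hg : g < 1) :
    ∀ᶠ n : ℕ in atTop, threshold α ν g n + 3 ≤ R ν n := by
  have hT : Tendsto (fun n : ℕ => Real.exp (α * R ν n / 2)) atTop atTop :=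
    Real.tendsto_exp_atTop.comp (((tendsto_R hν).const_mul_atTop hα).atTop_div_const two_pos)
  have hy := tendsto_natCast_rpow_neg (e := -(1 - g) / 2) (by linarith)
  set c := Real.exp (-(3 * α / 2)) with hc
  have hc0 : 0 < c := Real.exp_pos _
  filter_upwards [(tendsto_R hν).eventually_ge_atTop 0, hT.eventually_ge_atTop (2 / c),
    hy.eventually_le_const (half_pos hc0)] with n hR hTn hyn
  have h1 := exp_mul_threshold_le (g := g) hα hR
  set T := Real.exp (α * R ν n / 2) with hTd
  have hT0 : 0 < T := Real.exp_pos _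
  have h2 : Real.exp (α * threshold α ν g n / 2) ≤ Real.exp (-(3 * α / 2) + α * R ν n / 2) := by
    rw [Real.exp_add, ← hc, ← hTd]
    have h3 : 2 ≤ T * c := (div_le_iff₀ hc0).1 hTn
    nlinarith
  have h3 := Real.exp_le_exp.1 h2
  nlinarith

theorem threshold_nonneg {α ν g : ℝ} {n : ℕ} (hα : 0 < α) (hR : 0 ≤ R ν n) :
    0 ≤ threshold α ν g n := by
  have hS : 0 ≤ Real.sinh (α * R ν n / 2) := Real.sinh_nonneg_iff.2 (by positivity)
  have := Real.arsinh_nonneg_iff.2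
    (show 0 ≤ (n : ℝ) ^ (-(1 - g) / 2) * Real.sinh (α * R ν n / 2) by positivity)
  unfold threshold
  positivity

/-- Since cosh x - 1 = 2 sinh²(x/2), the distribution function is a ratio of squares of sinh; the
arsinh in `threshold` makes this identity exact. -/
theorem cosh_threshold_ratio {α ν g : ℝ} {n : ℕ} (hα : 0 < α) (hR : 0 < R ν n) (hn : 0 < n) :
    (Real.cosh (α * threshold α ν g n) - 1) / (Real.cosh (α * R ν n) - 1) = (n : ℝ) ^ (g - 1) := by
  have hn' : (0 : ℝ) < n := by exact_mod_cast hn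
  have hS : 0 < Real.sinh (α * R ν n / 2) := Real.sinh_pos_iff.2 (by positivity)
  rw [cosh_mul_sub_one, cosh_mul_sub_one, mul_threshold hα, mul_div_cancel_left₀ _ two_ne_zero,
    Real.sinh_arsinh, mul_pow, ← Real.rpow_natCast, ← Real.rpow_mul hn'.le]
  rw [show -(1 - g) / 2 * ((2 : ℕ) : ℝ) = g - 1 by push_cast; ring]
  field_simp

/-- Up to the threshold, the decrease of the mass of a ball dominates its fluctuation. -/
theorem eventually_mass_condition {α ν g b θ D : ℝ} (hα : 0 < α) (hν : 0 < ν) (hg : 0 < g)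
    (hθ : 0 ≤ θ) (hD : 0 < D) (hg1 : g < 1)
    (hb : b + g + (2 * max (α - 1 / 2) 0 + g) * θ / α < 1 / 2)
    (hmass : ∀ᶠ n : ℕ in atTop, ∀ r, 0 ≤ r → r ≤ R ν n →
      √(ballMass α ν n r) ≤ D * Real.exp ((θ - 1 / 2) * r)) :
    ∀ᶠ n : ℕ in atTop, ∀ r, 0 ≤ r → r ≤ threshold α ν g n →
      2 * (n : ℝ) ^ (-(1 / 2) + g) * √(ballMass α ν n r) ≤
        gapConst α * (n : ℝ) ^ (-b) * Real.exp (-(r / 2)) := by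
  set m := max (α - 1 / 2) 0 with hm
  have hm0 : 0 ≤ m := le_max_right _ _
  have hm1 : α - 1 / 2 ≤ m := le_max_left _ _
  set κ := 1 / 2 - (b + g + (2 * m + g) * θ / α) with hκ
  have hκ0 : 0 < κ := by linarith
  set c := 1 + ν ^ (-α) with hc
  have hνα : 0 < ν ^ (-α) := Real.rpow_pos_of_pos hν _
  have hc0 : 0 < c := by positivity
  set C := 2 * D * c ^ (2 * θ / α) with hC
  have hC0 : 0 < C := by positivity
  have hlim := tendsto_natCast_rpow_neg (e := -κ) (by linarith)
  filter_upwards [hmass, eventually_threshold_add_le hα hν hg1, eventually_ge_atTop 1,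
    (tendsto_R hν).eventually_ge_atTop 0,
    hlim.eventually_le_const (div_pos (gapConst_pos hα) hC0)] with n hn hM hn1 hR hsmall r hr hrM
  have hn0 : (0 : ℝ) < n := by exact_mod_cast hn1
  have hn1' : (1 : ℝ) ≤ n := by exact_mod_cast hn1
  -- The growing term has exponent α - 1/2 + g/2, which may be negative; the constant 1 then
  -- dominates, hence the maximum in m.
  have h1 : Real.exp (α * threshold α ν g n / 2) ≤ c * (n : ℝ) ^ (m + g / 2) := by
    refine (exp_mul_threshold_le hα hR).trans ?_
    rw [exp_half_mul_R hν hn1, ← mul_assoc, ← Real.rpow_add hn0]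
    have e1 : (1 : ℝ) ≤ (n : ℝ) ^ (m + g / 2) := Real.one_le_rpow hn1' (by positivity)
    have e2 : (n : ℝ) ^ (-(1 - g) / 2 + α) ≤ (n : ℝ) ^ (m + g / 2) :=
      Real.rpow_le_rpow_of_exponent_le hn1' (by linarith)
    rw [hc, add_mul, one_mul, mul_comm (ν ^ (-α))]
    exact add_le_add e1 (mul_le_mul_of_nonneg_right e2 hνα.le)
  have h2 : Real.exp (θ * r) ≤ c ^ (2 * θ / α) * (n : ℝ) ^ ((2 * m + g) * θ / α) := by
    calc Real.exp (θ * r) ≤ Real.exp (θ * threshold α ν g n) := by gcongr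
      _ = Real.exp (α * threshold α ν g n / 2) ^ (2 * θ / α) := by
          rw [← Real.exp_mul]; congr 1; field_simp
      _ ≤ (c * (n : ℝ) ^ (m + g / 2)) ^ (2 * θ / α) :=
          Real.rpow_le_rpow (Real.exp_pos _).le h1 (by positivity)
      _ = _ := by
          rw [Real.mul_rpow hc0.le (by positivity), ← Real.rpow_mul hn0.le]
          congr 2; field_simp
  have h3 : √(ballMass α ν n r) ≤ D * (Real.exp (θ * r) * Real.exp (-(r / 2))) := by
    refine (hn r hr (by linarith)).trans (le_of_eq ?_)
    rw [← Real.exp_add]; ring_nf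
  have h4 : C * (n : ℝ) ^ (-κ) ≤ gapConst α := by
    rw [le_div_iff₀ hC0] at hsmall; linarith
  have h5 : (n : ℝ) ^ (-(1 / 2) + g) * (n : ℝ) ^ ((2 * m + g) * θ / α) =
      (n : ℝ) ^ (-κ) * (n : ℝ) ^ (-b) := by
    rw [← Real.rpow_add hn0, ← Real.rpow_add hn0]; congr 1; rw [hκ]; ring
  calc 2 * (n : ℝ) ^ (-(1 / 2) + g) * √(ballMass α ν n r)
      ≤ 2 * (n : ℝ) ^ (-(1 / 2) + g) * (D * ((c ^ (2 * θ / α) *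
          (n : ℝ) ^ ((2 * m + g) * θ / α)) * Real.exp (-(r / 2)))) := by
        refine mul_le_mul_of_nonneg_left (h3.trans ?_) (by positivity)
        gcongr
    _ = C * ((n : ℝ) ^ (-(1 / 2) + g) * (n : ℝ) ^ ((2 * m + g) * θ / α)) *
          Real.exp (-(r / 2)) := by rw [hC]; ring
    _ = C * (n : ℝ) ^ (-κ) * (n : ℝ) ^ (-b) * Real.exp (-(r / 2)) := by rw [h5]; ring
    _ ≤ _ := by gcongr

/-- The bound for the probability that some radius is close to one below the threshold. -/
theorem eventually_window_le {α ν g b : ℝ} (hα : 0 < α) (hν : 0 < ν) (hb : 0 < b) :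
    ∃ C, ∀ᶠ n : ℕ in atTop, (n : ℝ) ^ 2 * ((n : ℝ) ^ (g - 1) *
      (α * Real.sinh (α * (threshold α ν g n + (n : ℝ) ^ (-b))) / (Real.cosh (α * R ν n) - 1) *
        (n : ℝ) ^ (-b))) ≤
      C * ((n : ℝ) ^ (1 / 2 - α + 3 * g / 2 - b) + (n : ℝ) ^ (2 * g - b) +
        (n : ℝ) ^ (1 + g - 2 * α - 2 * b)) := by
  set K := Real.exp α * (2 + 2 * α) with hK
  have hK0 : 0 < K := by positivity
  have hνα : 0 < ν ^ α := Real.rpow_pos_of_pos hν _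
  set q := 4 * ν ^ α with hq
  have hq0 : 0 < q := by positivity
  refine ⟨α * K / 2 * (1 + q + q ^ 2), ?_⟩
  have hT : Tendsto (fun n : ℕ => Real.exp (α * R ν n / 2)) atTop atTop :=
    Real.tendsto_exp_atTop.comp (((tendsto_R hν).const_mul_atTop hα).atTop_div_const two_pos)
  filter_upwards [eventually_ge_atTop 1, (tendsto_R hν).eventually_gt_atTop 0,
    hT.eventually_ge_atTop 2] with n hn1 hR hT2
  have hn0 : (0 : ℝ) < n := by exact_mod_cast hn1
  have hn1' : (1 : ℝ) ≤ n := by exact_mod_cast hn1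
  set S := Real.sinh (α * R ν n / 2) with hS
  have hS0 : 0 < S := Real.sinh_pos_iff.2 (by positivity)
  have hS1 : (n : ℝ) ^ α * ν ^ (-α) / 4 ≤ S := by
    rw [← exp_half_mul_R hν hn1, hS, Real.sinh_eq]
    have : Real.exp (-(α * R ν n / 2)) ≤ 1 := Real.exp_le_one_iff.2 (by
      have := mul_pos hα hR; linarith)
    linarith
  set N := (n : ℝ) ^ (-α) with hN
  have hN0 : 0 < N := by positivity
  have hSi : 1 / S ≤ q * N := by
    rw [div_le_iff₀ hS0]
    calc (1 : ℝ) = q * N * ((n : ℝ) ^ α * ν ^ (-α) / 4) := by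
          rw [hq, hN, Real.rpow_neg hn0.le, Real.rpow_neg hν.le]; field_simp
      _ ≤ _ := by gcongr
  set η := (n : ℝ) ^ (-b) with hη
  have hη0 : 0 < η := by positivity
  have hη1 : η ≤ 1 := Real.rpow_le_one_of_one_le_of_nonpos hn1' (by linarith)
  set y := (n : ℝ) ^ (-(1 - g) / 2) with hy
  have hy0 : 0 < y := by positivity
  have hyy : (n : ℝ) ^ (g - 1) = y ^ 2 := by
    rw [hy, ← Real.rpow_natCast, ← Real.rpow_mul hn0.le]; congr 1; push_cast; ring
  have h1 := sinh_two_mul_arsinh_add_le (a := y * S) hα (by positivity) hη0.le hη1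
  rw [mul_add, mul_threshold hα, cosh_mul_sub_one, ← hS, ← hy, hyy]
  calc (n : ℝ) ^ 2 * (y ^ 2 * (α * Real.sinh (2 * Real.arsinh (y * S) + α * η) / (2 * S ^ 2) * η))
      ≤ (n : ℝ) ^ 2 * (y ^ 2 * (α * (K * (y * S + (y * S) ^ 2 + η)) / (2 * S ^ 2) * η)) := by
        gcongr
    _ = α * K / 2 * ((n : ℝ) ^ 2 * y ^ 2 * η * (y * (1 / S) + y ^ 2 + η * (1 / S) ^ 2)) := by
        field_simp
    _ ≤ α * K / 2 * ((n : ℝ) ^ 2 * y ^ 2 * η * (y * (q * N) + y ^ 2 + η * (q * N) ^ 2)) := by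
        gcongr
    _ = α * K / 2 * (q * ((n : ℝ) ^ 2 * y ^ 3 * η * N) + (n : ℝ) ^ 2 * y ^ 4 * η +
          q ^ 2 * ((n : ℝ) ^ 2 * y ^ 2 * η ^ 2 * N ^ 2)) := by ring
    _ = α * K / 2 * (q * (n : ℝ) ^ (1 / 2 - α + 3 * g / 2 - b) + (n : ℝ) ^ (2 * g - b) +
          q ^ 2 * (n : ℝ) ^ (1 + g - 2 * α - 2 * b)) := by
        have e1 : (n : ℝ) ^ 2 * y ^ 3 * η * N = (n : ℝ) ^ (1 / 2 - α + 3 * g / 2 - b) := by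
          rw [hy, hη, hN, ← Real.rpow_natCast, ← Real.rpow_natCast, ← Real.rpow_mul hn0.le,
            ← Real.rpow_add hn0, ← Real.rpow_add hn0, ← Real.rpow_add hn0]
          congr 1; push_cast; ring
        have e2 : (n : ℝ) ^ 2 * y ^ 4 * η = (n : ℝ) ^ (2 * g - b) := by
          rw [hy, hη, ← Real.rpow_natCast, ← Real.rpow_natCast, ← Real.rpow_mul hn0.le,
            ← Real.rpow_add hn0, ← Real.rpow_add hn0]
          congr 1; push_cast; ring
        have e3 : (n : ℝ) ^ 2 * y ^ 2 * η ^ 2 * N ^ 2 = (n : ℝ) ^ (1 + g - 2 * α - 2 * b) := by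
          rw [hy, hη, hN, ← Real.rpow_natCast, ← Real.rpow_natCast, ← Real.rpow_natCast,
            ← Real.rpow_natCast, ← Real.rpow_mul hn0.le, ← Real.rpow_mul hn0.le,
            ← Real.rpow_mul hn0.le, ← Real.rpow_add hn0, ← Real.rpow_add hn0, ← Real.rpow_add hn0]
          congr 1; push_cast; ring
        rw [e1, e2, e3]
    _ ≤ _ := by
        rw [mul_assoc (α * K / 2)]
        refine mul_le_mul_of_nonneg_left ?_ (by positivity)
        set A := (n : ℝ) ^ (1 / 2 - α + 3 * g / 2 - b)
        set B := (n : ℝ) ^ (2 * g - b)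
        set E := (n : ℝ) ^ (1 + g - 2 * α - 2 * b)
        have hA : 0 ≤ A := by positivity
        have hB : 0 ≤ B := by positivity
        have hE : 0 ≤ E := by positivity
        have : (1 + q + q ^ 2) * (A + B + E) = q * A + B + q ^ 2 * E +
          ((1 + q ^ 2) * A + (q + q ^ 2) * B + (1 + q) * E) := by ring
        rw [this]
        have : 0 ≤ (1 + q ^ 2) * A + (q + q ^ 2) * B + (1 + q) * E := by positivity
        linarith

theorem tendsto_sq_mul_exp_neg_rpow {s c : ℝ} (hs : 0 < s) (hc : 0 < c) :
    Tendsto (fun n : ℕ => (n : ℝ) ^ 2 * Real.exp (-(c * (n : ℝ) ^ s))) atTop (𝓝 0) := by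
  -- With x = n^s, the factor n² is x^(2/s).
  have h := (tendsto_rpow_mul_exp_neg_mul_atTop_nhds_zero (2 / s) c hc).comp
    (tendsto_natCast_rpow hs)
  refine h.congr fun n => ?_
  simp only [Function.comp_apply]
  rw [← Real.rpow_mul (Nat.cast_nonneg n), mul_div_cancel₀ _ hs.ne', neg_mul]
  norm_cast

theorem tendsto_nodesLaw_real_compl_orderingEvent {α ν : ℝ} (hα : 0 < α) (hν : 0 < ν) (k : ℕ) :
    Tendsto (fun n : ℕ => (nodesLaw α ν n).real (orderingEvent ν k n)ᶜ) atTop (𝓝 0) := by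
  obtain ⟨g, b, θ, D, hg, hb, hθ, hD, hb1, hb2, hb3, hmass⟩ := exists_exponents hα hν
  have hm : 0 ≤ (2 * max (α - 1 / 2) 0 + g) * θ / α := by
    have := le_max_right (α - 1 / 2) 0
    positivity
  have hg1 : g < 1 := by linarith
  obtain ⟨C, hC⟩ := eventually_window_le (g := g) hα hν hb
  have hlim : Tendsto (fun n : ℕ => 2 ^ k * Real.exp (-((n : ℝ) ^ g / 2)) +
      C * ((n : ℝ) ^ (1 / 2 - α + 3 * g / 2 - b) + (n : ℝ) ^ (2 * g - b) +
        (n : ℝ) ^ (1 + g - 2 * α - 2 * b)) +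
      (n : ℝ) ^ 2 * Real.exp (-(1 / 8 * (n : ℝ) ^ (2 * g)))) atTop (𝓝 0) := by
    have h1 : Tendsto (fun n : ℕ => 2 ^ k * Real.exp (-((n : ℝ) ^ g / 2))) atTop (𝓝 (2 ^ k * 0)) :=
      (Real.tendsto_exp_neg_atTop_nhds_zero.comp
        ((tendsto_natCast_rpow hg).atTop_div_const two_pos)).const_mul _
    -- The third exponent needs no condition of its own: it is twice the first one minus 2g.
    have h2 := (((tendsto_natCast_rpow_neg (e := 1 / 2 - α + 3 * g / 2 - b) (by linarith)).add
      (tendsto_natCast_rpow_neg (e := 2 * g - b) (by linarith))).add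
      (tendsto_natCast_rpow_neg (e := 1 + g - 2 * α - 2 * b) (by linarith))).const_mul C
    have h3 := tendsto_sq_mul_exp_neg_rpow (s := 2 * g) (c := 1 / 8) (by linarith) (by norm_num)
    simpa using (h1.add h2).add h3
  refine tendsto_of_tendsto_of_tendsto_of_le_of_le' tendsto_const_nhds hlim
    (Eventually.of_forall fun n => measureReal_nonneg) ?_
  filter_upwards [hC, eventually_mass_condition hα hν hg hθ hD hg1 hb3 hmass,
    eventually_threshold_add_le hα hν hg1, eventually_ge_atTop 4,
    (tendsto_R hν).eventually_ge_atTop (5 + 1 / α)] with n hCn hcond hM hn4 hR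
  have hα' : 0 < 1 / α := by positivity
  have hR0 : 0 < R ν n := by linarith
  have hn0 : 0 < n := by omega
  have hn0' : (0 : ℝ) < n := by exact_mod_cast hn0
  have hn4' : (4 : ℝ) ≤ n := by exact_mod_cast hn4
  refine (nodesLaw_real_compl_orderingEvent_le hα hR (threshold_nonneg hα hR0.le) hM
    (Real.rpow_pos_of_pos hn0' (-b))
    (Real.rpow_le_one_of_one_le_of_nonpos (by linarith) (by linarith))
    (Real.rpow_pos_of_pos hn0' (-(1 / 2) + g)) hcond k).trans ?_
  rw [cosh_threshold_ratio hα hR0 hn0]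
  refine add_le_add (add_le_add (le_of_eq ?_) hCn) ?_
  · congr 4
    rw [Real.rpow_sub hn0', Real.rpow_one]; field_simp
  -- For n ≥ 4 one has n - 2 ≥ n/2, so (n - 2)ε²/4 ≥ nε²/8 = n^(2g)/8.
  · refine mul_le_mul_of_nonneg_left (Real.exp_le_exp.2 (neg_le_neg ?_)) (by positivity)
    have e1 : ((n : ℝ) ^ (-(1 / 2) + g)) ^ 2 * n = (n : ℝ) ^ (2 * g) := by
      nth_rewrite 2 [← Real.rpow_one (n : ℝ)]
      rw [← Real.rpow_natCast, ← Real.rpow_mul hn0'.le, ← Real.rpow_add hn0']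
      congr 1; push_cast; ring
    rw [← e1]
    have := sq_nonneg ((n : ℝ) ^ (-(1 / 2) + g))
    nlinarith

end RHG

end

theorem theorem3p1 (α ν : ℝ) (hα : 0 < α) (hν : 0 < ν) (k : ℕ) (hk : 1 ≤ k) :
    Tendsto (fun n : ℕ => RHG.nodesLaw α ν n (RHG.orderingEvent ν k n)) atTop (𝓝 1) := by
  have h := ENNReal.tendsto_ofReal
    ((RHG.tendsto_nodesLaw_real_compl_orderingEvent hα hν k).const_sub 1)
  rw [sub_zero, ENNReal.ofReal_one] at h
  have hprob : ∀ᶠ n : ℕ in atTop, IsProbabilityMeasure (RHG.nodesLaw α ν n) := by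
    filter_upwards [(RHG.tendsto_R hν).eventually_gt_atTop 0] with n hR
    have := RHG.isProbabilityMeasure_nodeLaw hα hR
    exact Measure.pi.instIsProbabilityMeasure _
  refine tendsto_of_tendsto_of_tendsto_of_le_of_le' h tendsto_const_nhds ?_ ?_
  · filter_upwards [hprob] with n hn
    rw [← ofReal_measureReal]
    refine ENNReal.ofReal_le_ofReal ?_
    -- Subadditivity alone bounds the probability from below, so measurability of the ordering event
    -- is never used.
    have h1 := measureReal_union_le (μ := RHG.nodesLaw α ν n) (RHG.orderingEvent ν k n)
      (RHG.orderingEvent ν k n)ᶜ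
    rw [Set.union_compl_self, probReal_univ] at h1
    linarith
  · filter_upwards [hprob] with n hn using prob_le_one
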